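/- Let $n,m,K\ge 0$ be integers and let $\Lambda^K B_{n,m}$ be the set of $n\times m$ matrices with entries in $\{0,1\}$ and exactly $K$ ones. *Crystals.* For $k\ge 0$ let $\mathcal E_k=\bigsqcup_j \mathcal B^{\mathfrak{gl}_k}_{\varpi_j}$ be the $\mathfrak{gl}_k$-crystal of all $c\in\{0,1\}^k$, with $\mathrm{wt}(c)=c\in\mathbb Z^k$, where for $1\le i\le k-1$ the operator $e_i$ replaces $(c_i,c_{i+1})=(0,1)$ by $(1,0)$ and is $0$ otherwise, $f_i$ replaces $(1,0)$ by $(0,1)$ and is $0$ otherwise, and $\epsilon_i(c)$, $\phi_i(c)$ equal $1$ or $0$ according to whether $e_i(c)\neq 0$, $f_i(c)\ne0$. Write $\langle\mu,\alpha_i^\vee\rangle=\mu_i-\mu_{i+1}$. On a tensor product, $\mathrm{wt}(b_1\otimes\cdots\otimes b_r)=\sum_j\mathrm{wt}(b_j)$, and with $\epsilon_i^s=\epsilon_i(b_s)-\langle \sum_{j<s}\mathrm{wt}(b_j),\alpha_i^\vee\rangle$, $\phi_i^s=\phi_i(b_s)+\langle \sum_{j>s}\mathrm{wt}(b_j),\alpha_i^\vee\rangle$,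 $\epsilon_i=\max_s\{\epsilon_i^s,0\}$, $\phi_i=\max_s\{\phi_i^s,0\}$, the operator $e_i$ acts on the factor with the smallest index $s$ such that $\epsilon_i^s=\epsilon_i$ and $f_i$ acts on the factor with the largest index $t$ such that $\phi_i^t=\phi_i$. A $0/1$ matrix with rows $r_1,\dots,r_n$ is regarded as the element $r_1\otimes\cdots\otimes r_n$ of the $\mathfrak{gl}_m$-crystal $\mathcal E_m^{\otimes n}$, and a $0/1$ matrix with columns $c_1,\dots,c_m$ as the element $c_m\otimes\cdots\otimes c_1$ of the $\mathfrak{gl}_n$-crystal $\mathcal E_n^{\otimes m}$. *Schützenberger involutions.* For a $\mathfrak{gl}_k$-crystal $B$ and $1\le p<q\le k$, $\xi_{p,q}:B\to B$ is the unique map that preserves every connected component of the crystal graph restricted to the labels $\{p,\dots,q-1\}$, satisfies $e_i\,\xi_{p,q}(b)=\xi_{p,q}(f_{p+q-1-i}\,b)$ and $f_i\,\xi_{p,q}(b)=\xi_{p,q}(e_{p+q-1-i}\,b)$ for all $b\in B$ and $p\le i\le q-1$ (with $\xi_{p,q}(0)=0$), and acts on weights by reversing the coordinates $p,\dots,q$.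 Write $\xi=\xi_{1,k}$ for the involution of the whole crystal (the identity if $k\le 1$). *Cactus actions.* Let $C_m$ be the cactus group of $\mathfrak{gl}_m$, with generators $s_{p,q}$, $1\le p<q\le m$. The inner action of $s_{p,q}$ on $0/1$ matrices is $s^{\mathrm i}_{p,q}=\xi_{p,q}$ for the $\mathfrak{gl}_m$-crystal structure. The outer action of $s_{p,q}$ is defined on $m$-fold tensor products of $\mathfrak{gl}_n$-crystals by $$s^{\mathrm o}_{p,q}(b_1\otimes\cdots\otimes b_m)=b_1\otimes\cdots\otimes b_{p-1}\otimes\xi\bigl(\xi(b_q)\otimes\xi(b_{q-1})\otimes\cdots\otimes\xi(b_p)\bigr)\otimes b_{q+1}\otimes\cdots\otimes b_m,$$ and on $0/1$ matrices through $c_m\otimes\cdots\otimes c_1$. **Corollary.** Let $1\le p<q\le m$. The Schützenberger involutions that enter $s^{\mathrm i}_{p,q}$ and $s^{\mathrm o}_{m+1-q,m+1-p}$ exist and are unique, and for every $N\in\Lambda^K B_{n,m}$ one has $s^{\mathrm o}_{m+1-q,\,m+1-p}(N)\in\Lambda^K B_{n,m}$ and $$s^{\mathrm o}_{m+1-q,\,m+1-p}(N)=s^{\mathrm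 i}_{p,q}(N).$$ -/

import Mathlib

/-! Positions, simple roots and tensor factors are numbered from `0`: the position `a : Fin k` is
the `(a + 1)`-st coordinate of the weight lattice `ℤ ^ k` of `gl_k`, and `i : Fin (k - 1)` is the
simple root `ε_i - ε_{i+1}` joining the positions `i` and `i + 1`. -/

/-- The maps of a `gl_k`-crystal on the set `B`; the value `none` of a Kashiwara operator is `0`. -/
structure GLCrystalData (k : ℕ) (B : Type) where
  e : Fin (k - 1) → B → Option B
  f : Fin (k - 1) → B → Option B
  eps : Fin (k - 1) → B → ℤ
  phi : Fin (k - 1) → B → ℤ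
  wt : B → Fin k → ℤ

/-- The first position of the simple root `i`. -/
def rootLo {k : ℕ} (i : Fin (k - 1)) : Fin k := ⟨i.val, by have := i.isLt; omega⟩

/-- The second position of the simple root `i`. -/
def rootHi {k : ℕ} (i : Fin (k - 1)) : Fin k := ⟨i.val + 1, by have := i.isLt; omega⟩

/-- The pairing of a weight with the simple coroot `α_i^∨`. -/
def corootPairing {k : ℕ} (i : Fin (k - 1)) (w : Fin k → ℤ) : ℤ := w (rootLo i) - w (rootHi i)

/-- The disjoint union over `j` of the crystals of the fundamental representations `Λ^j ℂ^k`: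
its elements are the `0/1`-vectors of length `k`, the `j`-th piece consisting of those with exactly
`j` ones. The operator `e_i` moves a one from position `i + 1` to position `i`, and `f_i` moves it
back, when possible. -/
def exteriorCrystal (k : ℕ) : GLCrystalData k (Fin k → Bool) where
  e i c := if c (rootLo i) = false ∧ c (rootHi i) = true then
    some (c ∘ Equiv.swap (rootLo i) (rootHi i)) else none
  f i c := if c (rootLo i) = true ∧ c (rootHi i) = false then
    some (c ∘ Equiv.swap (rootLo i) (rootHi i)) else none
  eps i c := if c (rootLo i) = false ∧ c (rootHi i) = true then 1 else 0
  phi i c := if c (rootLo i) = true ∧ c (rootHi i) = false then 1 else 0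
  wt c a := if c a = true then 1 else 0

namespace GLCrystalData

variable {k : ℕ} {B : Type}

/-- `ε_i^s (b_0 ⊗ ⋯ ⊗ b_{r-1}) = ε_i (b_s) - ⟨α_i^∨, wt b_0 + ⋯ + wt b_{s-1}⟩`. -/
def tensorEpsAt (C : GLCrystalData k B) {r : ℕ} (i : Fin (k - 1)) (b : Fin r → B)
    (s : Fin r) : ℤ :=
  C.eps i (b s) - corootPairing i (∑ j ∈ Finset.Iio s, C.wt (b j))

/-- `φ_i^s (b_0 ⊗ ⋯ ⊗ b_{r-1}) = φ_i (b_s) + ⟨α_i^∨, wt b_{s+1} + ⋯ + wt b_{r-1}⟩`. -/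
def tensorPhiAt (C : GLCrystalData k B) {r : ℕ} (i : Fin (k - 1)) (b : Fin r → B)
    (s : Fin r) : ℤ :=
  C.phi i (b s) + corootPairing i (∑ j ∈ Finset.Ioi s, C.wt (b j))

/-- `ε_i = max_s {ε_i^s, 0}`. -/
def tensorEps (C : GLCrystalData k B) {r : ℕ} (i : Fin (k - 1)) (b : Fin r → B) : ℤ :=
  Finset.univ.fold max 0 (C.tensorEpsAt i b)

/-- `φ_i = max_s {φ_i^s, 0}`. -/
def tensorPhi (C : GLCrystalData k B) {r : ℕ} (i : Fin (k - 1)) (b : Fin r → B) : ℤ :=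
  Finset.univ.fold max 0 (C.tensorPhiAt i b)

/-- The tensor power `C ⊗ ⋯ ⊗ C` with `r` factors; `b : Fin r → B` is `b_0 ⊗ ⋯ ⊗ b_{r-1}`.
The operator `e_i` acts on the factor with the smallest index `s` such that `ε_i^s = ε_i`, and `f_i`
on the factor with the largest index `t` such that `φ_i^t = φ_i`. -/
def tensorPower (C : GLCrystalData k B) (r : ℕ) : GLCrystalData k (Fin r → B) where
  e i b :=
    if h : (Finset.univ.filter fun s => C.tensorEpsAt i b s = C.tensorEps i b).Nonempty then
      let s := Finset.min' _ h
      (C.e i (b s)).map (Function.update b s)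
    else none
  f i b :=
    if h : (Finset.univ.filter fun t => C.tensorPhiAt i b t = C.tensorPhi i b).Nonempty then
      let t := Finset.max' _ h
      (C.f i (b t)).map (Function.update b t)
    else none
  eps i b := C.tensorEps i b
  phi i b := C.tensorPhi i b
  wt b := ∑ j, C.wt (b j)

/-- Transport of a crystal along a bijection of the underlying sets. -/
def transport {A : Type} (C : GLCrystalData k B) (g : A ≃ B) : GLCrystalData k A where
  e i a := (C.e i (g a)).map g.symm
  f i a := (C.f i (g a)).map g.symm
  eps i a := C.eps i (g a)
  phi i a := C.phi i (g a)
  wt a := C.wt (g a)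

/-- `b` and `b'` lie in the same connected component of the crystal graph restricted to the
arrows with labels in `J`. -/
def SameComponent (C : GLCrystalData k B) (J : Set (Fin (k - 1))) : B → B → Prop :=
  Relation.EqvGen fun b b' => ∃ i ∈ J, C.f i b = some b'

/-- The defining property of the Schützenberger involution of the restriction of `C` to a set `J`
of simple roots with diagram automorphism `θ` and longest Weyl group element `w`: it maps every
connected component of the restricted crystal to itself, exchanges the raising and the lowering
operators through `θ`, and acts on weights by `w`. -/
structure IsSchutzenberger (C : GLCrystalData k B) (J : Set (Fin (k - 1)))
    (θ : Fin (k - 1) → Fin (k - 1)) (w : Fin k → Fin k) (ξ : B → B) : Prop where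
  component : ∀ b, C.SameComponent J b (ξ b)
  e_comm : ∀ i ∈ J, ∀ b, C.e i (ξ b) = (C.f (θ i) b).map ξ
  f_comm : ∀ i ∈ J, ∀ b, C.f i (ξ b) = (C.e (θ i) b).map ξ
  wt_comm : ∀ b a, C.wt (ξ b) a = C.wt b (w a)

/-- The Schützenberger property for the whole Dynkin diagram of `gl_k`: here `θ` and `w_0` reverse
the order of the simple roots and of the positions. -/
def IsFullSchutzenberger (C : GLCrystalData k B) (ξ : B → B) : Prop :=
  C.IsSchutzenberger Set.univ Fin.rev Fin.rev ξ

/-- The simple roots joining the positions of the interval `[p, q]`. -/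
def intervalRoots (p q : Fin k) : Set (Fin (k - 1)) :=
  {i | p.val ≤ i.val ∧ i.val < q.val}

/-- The diagram automorphism of `intervalRoots p q`, which reverses the order. -/
def intervalTheta (p q : Fin k) (i : Fin (k - 1)) : Fin (k - 1) :=
  if h : p.val ≤ i.val ∧ i.val < q.val then
    ⟨p.val + q.val - 1 - i.val, by have := q.isLt; omega⟩
  else i

/-- The longest Weyl group element for `intervalRoots p q`, which reverses the order of the
positions in `[p, q]` and fixes the others. -/
def intervalRev (p q : Fin k) (a : Fin k) : Fin k :=
  if h : p.val ≤ a.val ∧ a.val ≤ q.val then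
    ⟨p.val + q.val - a.val, by have := q.isLt; omega⟩
  else a

/-- The Schützenberger property for the subdiagram `intervalRoots p q`. -/
def IsIntervalSchutzenberger (C : GLCrystalData k B) (p q : Fin k) (ξ : B → B) : Prop :=
  C.IsSchutzenberger (intervalRoots p q) (intervalTheta p q) (intervalRev p q) ξ

open Classical in
/-- The Schützenberger involution of a `gl_k`-crystal. -/
noncomputable def schutzenberger (C : GLCrystalData k B) : B → B :=
  if h : ∃ ξ, C.IsFullSchutzenberger ξ then h.choose else id

open Classical in
/-- The inner action of the generator `s_{p,q}` of the cactus group `C_k` on a `gl_k`-crystal: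
the Schützenberger involution of its restriction to the subdiagram `intervalRoots p q`. -/
noncomputable def innerCactus (C : GLCrystalData k B) (p q : Fin k) : B → B :=
  if h : ∃ ξ, C.IsIntervalSchutzenberger p q ξ then h.choose else id

/-- The outer action of the generator `s_{p,q}` of the cactus group `C_r` on an `r`-fold tensor
power: `b_0 ⊗ ⋯ ⊗ b_{r-1}` is sent to
`b_0 ⊗ ⋯ ⊗ b_{p-1} ⊗ ξ (ξ b_q ⊗ ξ b_{q-1} ⊗ ⋯ ⊗ ξ b_p) ⊗ b_{q+1} ⊗ ⋯ ⊗ b_{r-1}`. -/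
noncomputable def outerCactus (C : GLCrystalData k B) {r : ℕ} (p q : Fin r)
    (b : Fin r → B) : Fin r → B :=
  let c : Fin (q.val - p.val + 1) → B := fun j =>
    C.schutzenberger (b ⟨q.val - j.val, by have := q.isLt; omega⟩)
  let d : Fin (q.val - p.val + 1) → B :=
    (C.tensorPower (q.val - p.val + 1)).schutzenberger c
  fun s => if h : p.val ≤ s.val ∧ s.val ≤ q.val then d ⟨s.val - p.val, by omega⟩ else b s

end GLCrystalData

/-- The set `Λ^K B_{n,m}` of the `n × m` matrices with entries in `{0,1}` and exactly `K` ones. -/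
def LambdaB (K n m : ℕ) : Set (Matrix (Fin n) (Fin m) Bool) :=
  {M | (Finset.univ.filter fun x : Fin n × Fin m => M x.1 x.2 = true).card = K}

/-- A matrix with rows `r_1, …, r_n` corresponds to `r_1 ⊗ ⋯ ⊗ r_n`. -/
def rowTensor (n m : ℕ) : Matrix (Fin n) (Fin m) Bool ≃ (Fin n → Fin m → Bool) :=
  Matrix.of.symm

/-- A matrix with columns `c_1, …, c_m` corresponds to `c_m ⊗ ⋯ ⊗ c_1`. -/
def colTensor (n m : ℕ) : Matrix (Fin n) (Fin m) Bool ≃ (Fin m → Fin n → Bool) where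
  toFun M j i := M i j.rev
  invFun b := Matrix.of fun i j => b j.rev i
  left_inv M := by ext i j; simp
  right_inv b := by ext j i; simp

/-- The `gl_m`-crystal structure on all `n × m` matrices with entries in `{0,1}`, which is the
disjoint union over `K` of the `gl_m`-crystals `Λ^K B_{n,m}`. -/
def rowCrystal (n m : ℕ) : GLCrystalData m (Matrix (Fin n) (Fin m) Bool) :=
  ((exteriorCrystal m).tensorPower n).transport (rowTensor n m)

/-- The inner action of `s_{p,q} ∈ C_m` on matrices, through their `gl_m`-crystal structure. -/
noncomputable def innerAction (n m : ℕ) (p q : Fin m) :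
    Matrix (Fin n) (Fin m) Bool → Matrix (Fin n) (Fin m) Bool :=
  (rowCrystal n m).innerCactus p q

/-- The outer action of `s_{p,q} ∈ C_m` on matrices, seen as `m`-fold tensor products of elements
of `gl_n`-crystals through their columns. -/
noncomputable def outerAction (n m : ℕ) (p q : Fin m) :
    Matrix (Fin n) (Fin m) Bool → Matrix (Fin n) (Fin m) Bool :=
  fun M => (colTensor n m).symm ((exteriorCrystal n).outerCactus p q (colTensor n m M))

/-! The rows and the columns of an `n × m` matrix of zeros and ones give it a `gl_m`- and a
`gl_n`-crystal structure, and the two commute (skew Howe duality). A row component and a column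
component meet in at most one point, because a matrix of highest weight for both structures is a
Young diagram, hence determined by its row sums.

Rotation by a half-turn exchanges raising and lowering for both structures and preserves the
bicomponent of a matrix `M`. Hence the row component of `M` and the column component of its
half-turn have exactly one common point, which is the image of `M` under the Schützenberger
involution of the row structure. By symmetry it is also the image of the half-turn of `M` under the
involution of the column structure. Since a quarter-turn exchanges the two structures, this
expresses the column involution, hence the outer action on the block of columns `p, …, q`, through
the row involution of that block. -/

open Finset Relation

section Diamond

variable {α β : Type*} {R S : α → α → Prop}

/-- The relations `R` and `S` commute: an `R`-step and an `S`-step from a common point can be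
completed to a square. Commutation of crystal operators is stated in this form. -/
def Diamond (R S : α → α → Prop) : Prop :=
  ∀ ⦃a b c⦄, R a b → S a c → ∃ d, S b d ∧ R c d

namespace Diamond

lemma symm (h : Diamond R S) : Diamond S R := fun _ _ _ hS hR =>
  let ⟨d, hbd, hcd⟩ := h hR hS
  ⟨d, hcd, hbd⟩

lemma comap (h : Diamond R S) {g : β → α} (hg : g.Surjective) :
    Diamond (fun a b => R (g a) (g b)) (fun a b => S (g a) (g b)) := fun _ _ _ hR hS => by
  obtain ⟨d, hd⟩ := h hR hS
  obtain ⟨d, rfl⟩ := hg d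
  exact ⟨d, hd⟩

lemma reflTransGen_left (h : Diamond R S) : Diamond (ReflTransGen R) S := by
  intro a b c hab hac
  induction hab with
  | refl => exact ⟨c, hac, .refl⟩
  | tail _ hbb' ih =>
    obtain ⟨d, hbd, hcd⟩ := ih
    obtain ⟨d', hb'd', hdd'⟩ := h hbb' hbd
    exact ⟨d', hb'd', hcd.tail hdd'⟩

lemma eqvGen_left (h : Diamond R S) (h' : Diamond (flip R) S) : Diamond (EqvGen R) S := by
  rw [← EqvGen.reflTransGen_symmGen]
  refine reflTransGen_left ?_
  rintro a b c (hab | hba) hac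
  · obtain ⟨d, hbd, hcd⟩ := h hab hac
    exact ⟨d, hbd, .inl hcd⟩
  · obtain ⟨d, hbd, hdc⟩ := h' hba hac
    exact ⟨d, hbd, .inr hdc⟩

lemma equivalence_comp (h : Diamond R S) (hR : Equivalence R) (hS : Equivalence S) :
    Equivalence (Comp R S) where
  refl a := ⟨a, hR.refl a, hS.refl a⟩
  symm := fun ⟨_, hab, hbc⟩ =>
    let ⟨d, had, hcd⟩ := h (hR.symm hab) hbc
    ⟨d, hcd, hS.symm had⟩
  trans := fun ⟨_, hab, hbc⟩ ⟨_, hcd, hde⟩ =>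
    let ⟨x, hdx, hbx⟩ := h.symm (hS.symm hbc) hcd |>.imp fun _ => And.symm
    ⟨x, hR.trans hab hbx, hS.trans (hS.symm hdx) hde⟩

end Diamond

end Diamond

namespace GLCrystalData

section Lowering

variable {k l : ℕ} {B : Type} {C : GLCrystalData k B} {D : GLCrystalData l B}

/-- The arrow `b → b'` with label `i` of the crystal graph: `f_i b = b'`. -/
def Lowers (C : GLCrystalData k B) (i : Fin (k - 1)) (b b' : B) : Prop := C.f i b = some b'

/-- The crystal condition that makes `e_i` and `f_i` inverse to each other where they are
nonzero. -/
def IsPartialInverse (C : GLCrystalData k B) : Prop :=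
  ∀ i b b', C.e i b' = some b ↔ C.Lowers i b b'

/-- Connectedness in the whole crystal graph. -/
abbrev Connected (C : GLCrystalData k B) : B → B → Prop := C.SameComponent Set.univ

/-- A highest weight element: it receives no arrow of the crystal graph. -/
def IsHighest (C : GLCrystalData k B) (b : B) : Prop := ∀ i b', ¬ C.Lowers i b' b

/-- A lowest weight element: it emits no arrow of the crystal graph. -/
def IsLowest (C : GLCrystalData k B) (b : B) : Prop := ∀ i b', ¬ C.Lowers i b b'

/-- Every sequence of raising operators ends; this is the induction principle that leads from
highest weight elements to the whole crystal. -/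
def RaisingTerminates (C : GLCrystalData k B) : Prop :=
  WellFounded fun b' b => ∃ i, C.Lowers i b' b

/-- Every sequence of lowering operators ends. -/
def LoweringTerminates (C : GLCrystalData k B) : Prop :=
  WellFounded fun b' b => ∃ i, C.Lowers i b b'

lemma Lowers.right_unique {i : Fin (k - 1)} {b b₁ b₂ : B} (h₁ : C.Lowers i b b₁)
    (h₂ : C.Lowers i b b₂) : b₁ = b₂ :=
  Option.some_injective _ (h₁.symm.trans h₂)

lemma equivalence_sameComponent (C : GLCrystalData k B) (J : Set (Fin (k - 1))) :
    Equivalence (C.SameComponent J) := EqvGen.is_equivalence _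

lemma Lowers.connected {i : Fin (k - 1)} {b b' : B} (h : C.Lowers i b b') : C.Connected b b' :=
  .rel _ _ ⟨i, trivial, h⟩

lemma SameComponent.of_lowers {J : Set (Fin (k - 1))} {r : B → B → Prop} (hr : Equivalence r)
    (hJ : ∀ i ∈ J, ∀ b b', C.Lowers i b b' → r b b') {b b' : B} (h : C.SameComponent J b b') :
    r b b' := by
  induction h with
  | rel b b' h =>
    obtain ⟨i, hi, h⟩ := h
    exact hJ i hi b b' h
  | refl b => exact hr.refl b
  | symm _ _ _ ih => exact hr.symm ih
  | trans _ _ _ _ _ ih ih' => exact hr.trans ih ih'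

lemma RaisingTerminates.exists_isHighest (hC : C.RaisingTerminates) (b : B) :
    ∃ b', C.Connected b b' ∧ C.IsHighest b' := by
  induction b using hC.induction with | _ b ih
  by_cases hb : C.IsHighest b
  · exact ⟨b, .refl b, hb⟩
  · simp only [IsHighest, not_forall, not_not] at hb
    obtain ⟨i, x, hx⟩ := hb
    obtain ⟨b', hb', h⟩ := ih x ⟨i, hx⟩
    exact ⟨b', .trans _ _ _ (.symm _ _ hx.connected) hb', h⟩

lemma LoweringTerminates.exists_isLowest (hC : C.LoweringTerminates) (b : B) :
    ∃ b', C.Connected b b' ∧ C.IsLowest b' := by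
  induction b using hC.induction with | _ b ih
  by_cases hb : C.IsLowest b
  · exact ⟨b, .refl b, hb⟩
  · simp only [IsLowest, not_forall, not_not] at hb
    obtain ⟨i, x, hx⟩ := hb
    obtain ⟨b', hb', h⟩ := ih x ⟨i, hx⟩
    exact ⟨b', .trans _ _ _ hx.connected hb', h⟩

end Lowering

section Commute

variable {k l : ℕ} {B : Type} {C : GLCrystalData k B} {D : GLCrystalData l B}

/-- Two crystal structures on the same set commute: each raising or lowering operator of the first
commutes with each one of the second, and preserves whether the latter is nonzero. -/
structure Commute (C : GLCrystalData k B) (D : GLCrystalData l B) : Prop where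
  lowers_lowers : ∀ i j, Diamond (C.Lowers i) (D.Lowers j)
  lowers_raises : ∀ i j, Diamond (C.Lowers i) (flip (D.Lowers j))
  raises_lowers : ∀ i j, Diamond (flip (C.Lowers i)) (D.Lowers j)
  raises_raises : ∀ i j, Diamond (flip (C.Lowers i)) (flip (D.Lowers j))

namespace Commute

lemma symm (h : Commute C D) : Commute D C where
  lowers_lowers j i := (h.lowers_lowers i j).symm
  lowers_raises j i := (h.raises_lowers i j).symm
  raises_lowers j i := (h.lowers_raises i j).symm
  raises_raises j i := (h.raises_raises i j).symm

lemma connected_lowers (h : Commute C D) (j : Fin (l - 1)) :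
    Diamond C.Connected (D.Lowers j) :=
  Diamond.eqvGen_left
    (fun _ _ _ ⟨i, hi, hb⟩ hc =>
      (h.lowers_lowers i j hb hc).imp fun _ hd => ⟨hd.1, i, hi, hd.2⟩)
    (fun _ _ _ ⟨i, hi, hb⟩ hc =>
      (h.raises_lowers i j hb hc).imp fun _ hd => ⟨hd.1, i, hi, hd.2⟩)

lemma connected_raises (h : Commute C D) (j : Fin (l - 1)) :
    Diamond C.Connected (flip (D.Lowers j)) :=
  Diamond.eqvGen_left
    (fun _ _ _ ⟨i, hi, hb⟩ hc =>
      (h.lowers_raises i j hb hc).imp fun _ hd => ⟨hd.1, i, hi, hd.2⟩)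
    (fun _ _ _ ⟨i, hi, hb⟩ hc =>
      (h.raises_raises i j hb hc).imp fun _ hd => ⟨hd.1, i, hi, hd.2⟩)

lemma connected_connected (h : Commute C D) : Diamond C.Connected D.Connected :=
  Diamond.symm <| Diamond.eqvGen_left
    (fun _ _ _ ⟨j, hj, hb⟩ hc =>
      ((h.connected_lowers j).symm hb hc).imp fun _ hd => ⟨hd.1, j, hj, hd.2⟩)
    (fun _ _ _ ⟨j, hj, hb⟩ hc =>
      ((h.connected_raises j).symm hb hc).imp fun _ hd => ⟨hd.1, j, hj, hd.2⟩)

lemma isHighest_of_connected (h : Commute C D) {b b' : B} (hbb' : C.Connected b b')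
    (hb : D.IsHighest b) : D.IsHighest b' := fun j _ hx =>
  let ⟨y, hy, _⟩ := h.connected_raises j (.symm _ _ hbb') hx
  hb j y hy

lemma equivalence_comp_connected (h : Commute C D) :
    Equivalence (Comp C.Connected D.Connected) :=
  h.connected_connected.equivalence_comp (C.equivalence_sameComponent _)
    (D.equivalence_sameComponent _)

/-- The raising operators of `D` preserve `C`-highest weight and `C`-connectedness, so they reduce
the claim to elements that also have highest weight for `D`. -/
lemma eq_of_isHighest (h : Commute C D) (hD : D.RaisingTerminates)
    (huniq : ∀ ⦃b b'⦄, C.IsHighest b → D.IsHighest b → C.IsHighest b' → D.IsHighest b' →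
      C.Connected b b' → b = b')
    {b b' : B} (hb : C.IsHighest b) (hb' : C.IsHighest b') (hbb' : C.Connected b b') :
    b = b' := by
  induction b using hD.induction generalizing b' with | _ b ih
  by_cases hDb : D.IsHighest b
  · exact huniq hb hDb hb' (h.isHighest_of_connected hbb' hDb) hbb'
  · simp only [IsHighest, not_forall, not_not] at hDb
    obtain ⟨j, x, hx⟩ := hDb
    obtain ⟨x', hx', hxx'⟩ := h.connected_raises j hbb' hx
    have hCx : C.IsHighest x :=
      h.symm.isHighest_of_connected (.symm _ _ hx.connected) hb
    have hCx' : C.IsHighest x' :=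
      h.symm.isHighest_of_connected (.symm _ _ (Lowers.connected hx')) hb'
    obtain rfl := ih x ⟨j, hx⟩ hCx hCx' hxx'
    exact hx.right_unique hx'

lemma eq_of_connected (h : Commute C D) (hC : C.RaisingTerminates)
    (huniq : ∀ ⦃b b'⦄, C.IsHighest b → C.IsHighest b' → C.Connected b b' → b = b')
    {b b' : B} (hbb' : C.Connected b b') (hDbb' : D.Connected b b') : b = b' := by
  induction b using hC.induction generalizing b' with | _ b ih
  by_cases hb : C.IsHighest b
  · exact huniq hb (h.symm.isHighest_of_connected hDbb' hb) hbb'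
  · simp only [IsHighest, not_forall, not_not] at hb
    obtain ⟨i, x, hx⟩ := hb
    obtain ⟨x', hx', hxx'⟩ := h.symm.connected_raises i hDbb' hx
    have hCxx' : C.Connected x x' :=
      .trans _ _ _ hx.connected (.trans _ _ _ hbb' (.symm _ _ (Lowers.connected hx')))
    obtain rfl := ih x ⟨i, hx⟩ hCxx' hxx'
    exact hx.right_unique hx'

end Commute

end Commute

section Schutzenberger

variable {k l : ℕ} {B : Type} {C : GLCrystalData k B} {D : GLCrystalData l B}

lemma IsFullSchutzenberger.eq (hC : C.IsPartialInverse) (hlow : C.LoweringTerminates)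
    (huniq : ∀ ⦃b b'⦄, C.IsHighest b → C.IsHighest b' → C.Connected b b' → b = b')
    {ξ ξ' : B → B} (h : C.IsFullSchutzenberger ξ) (h' : C.IsFullSchutzenberger ξ') : ξ = ξ' := by
  funext b
  induction b using hlow.induction with | _ b ih
  have lowers_rev {ξ : B → B} (h : C.IsFullSchutzenberger ξ) {i : Fin (k - 1)} {b' : B}
      (hb : C.Lowers i b b') : C.Lowers i.rev (ξ b') (ξ b) := by
    rw [← hC, h.e_comm _ trivial, Fin.rev_rev, hb, Option.map_some]
  by_cases hb : C.IsLowest b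
  · have highest {ξ : B → B} (h : C.IsFullSchutzenberger ξ) : C.IsHighest (ξ b) := by
      intro i b' hb'
      rw [← hC, h.e_comm _ trivial, Option.map_eq_some_iff] at hb'
      obtain ⟨c, hc, -⟩ := hb'
      exact hb _ c hc
    exact huniq (highest h) (highest h')
      (.trans _ _ _ (.symm _ _ (h.component b)) (h'.component b))
  · simp only [IsLowest, not_forall, not_not] at hb
    obtain ⟨i, b', hb⟩ := hb
    have hξ := lowers_rev h hb
    rw [ih b' ⟨i, hb⟩] at hξ
    exact hξ.right_unique (lowers_rev h' hb)

/-- Both conditions on a Schützenberger involution concerning the Kashiwara operators are of this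
shape: there `R` and `S` are a lowering and a raising relation of the same crystal. -/
lemma rel_apply_iff (hmeet : ∀ ⦃b b'⦄, C.Connected b b' → D.Connected b b' → b = b')
    {ξ η : B → B} (hη : η.Surjective) (hξ : ∀ b, C.Connected b (ξ b))
    (hξη : ∀ b, D.Connected (ξ b) (η b)) {R S : B → B → Prop}
    (hRC : ∀ ⦃b b'⦄, R b b' → C.Connected b b') (hSC : ∀ ⦃b b'⦄, S b b' → C.Connected b b')
    (hDR : Diamond D.Connected R) (hRS : ∀ b b', R (η b) (η b') ↔ S b b') (b x : B) :
    R (ξ b) x ↔ ∃ y, S b y ∧ ξ y = x := by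
  have hC := C.equivalence_sameComponent Set.univ
  have hD := D.equivalence_sameComponent Set.univ
  have meets {x y : B} (hx : R (ξ b) x) (hy : S b y) (hxy : D.Connected x (η y)) : ξ y = x :=
    hmeet (hC.trans (hC.symm (hξ y)) (hC.trans (hC.symm (hSC hy)) (hC.trans (hξ b) (hRC hx))))
      (hD.trans (hξη y) (hD.symm hxy))
  constructor
  · intro hx
    obtain ⟨z, hz, hxz⟩ := hDR (hξη b) hx
    obtain ⟨y, rfl⟩ := hη z
    exact ⟨y, (hRS b y).1 hz, meets hx ((hRS b y).1 hz) hxz⟩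
  · rintro ⟨y, hy, rfl⟩
    obtain ⟨x, hx, hxy⟩ := hDR (hD.symm (hξη b)) ((hRS b y).2 hy)
    rwa [meets hx hy (hD.symm hxy)]

lemma Commute.isFullSchutzenberger (h : Commute C D) (hC : C.IsPartialInverse)
    (hmeet : ∀ ⦃b b'⦄, C.Connected b b' → D.Connected b b' → b = b') {ξ η : B → B}
    (hη : η.Surjective) (hηC : ∀ i b b', C.Lowers i (η b) (η b') ↔ C.Lowers i.rev b' b)
    (hηwt : ∀ b a, C.wt (η b) a = C.wt b a.rev)
    (hDwt : ∀ ⦃b b'⦄, D.Connected b b' → C.wt b = C.wt b')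
    (hξ : ∀ b, C.Connected b (ξ b)) (hξη : ∀ b, D.Connected (ξ b) (η b)) :
    C.IsFullSchutzenberger ξ where
  component := hξ
  e_comm i _ b := by
    ext x
    rw [hC, Option.map_eq_some_iff]
    exact rel_apply_iff hmeet hη hξ hξη (R := flip (C.Lowers i)) (S := C.Lowers i.rev)
      (fun _ _ hb => .symm _ _ (Lowers.connected hb)) (fun _ _ hb => hb.connected)
      (h.symm.connected_raises i) (fun _ _ => hηC i _ _) b x
  f_comm i _ b := by
    ext x
    have he (y : B) : C.e i.rev b = some y ↔ C.Lowers i.rev y b := hC _ _ _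
    simp only [Option.map_eq_some_iff, he]
    exact rel_apply_iff hmeet hη hξ hξη (R := C.Lowers i) (S := flip (C.Lowers i.rev))
      (fun _ _ hb => hb.connected) (fun _ _ hb => .symm _ _ (Lowers.connected hb))
      (h.symm.connected_lowers i) (hηC i) b x
  wt_comm b a := by rw [hDwt (hξη b), hηwt]

lemma schutzenberger_eq {ξ : B → B} (h : ∃! ξ, C.IsFullSchutzenberger ξ)
    (hξ : C.IsFullSchutzenberger ξ) : C.schutzenberger = ξ := by
  rw [schutzenberger, dif_pos h.exists]
  exact h.unique h.exists.choose_spec hξ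

lemma innerCactus_eq {p q : Fin k} {ξ : B → B} (h : ∃! ξ, C.IsIntervalSchutzenberger p q ξ)
    (hξ : C.IsIntervalSchutzenberger p q ξ) : C.innerCactus p q = ξ := by
  rw [innerCactus, dif_pos h.exists]
  exact h.unique h.exists.choose_spec hξ

lemma IsSchutzenberger.sum_wt_apply {J : Set (Fin (k - 1))} {θ : Fin (k - 1) → Fin (k - 1)}
    {w : Fin k → Fin k} {ξ : B → B} (h : C.IsSchutzenberger J θ w ξ) (hw : w.Involutive) (b : B) :
    ∑ a, C.wt (ξ b) a = ∑ a, C.wt b a := by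
  simp only [h.wt_comm]
  exact Equiv.sum_comp hw.toPerm (C.wt b)

lemma intervalRev_involutive (p q : Fin k) : (intervalRev p q).Involutive := by
  intro a
  unfold intervalRev
  grind

end Schutzenberger

section Transport

variable {k : ℕ} {A B : Type}

lemma transport_lowers_iff {C : GLCrystalData k B} (g : A ≃ B) {i : Fin (k - 1)} {a a' : A} :
    (C.transport g).Lowers i a a' ↔ C.Lowers i (g a) (g a') := by
  simp [Lowers, transport, Option.map_eq_some_iff, Equiv.symm_apply_eq]

lemma transport_e_eq_some_iff {C : GLCrystalData k B} (g : A ≃ B) {i : Fin (k - 1)} {a a' : A} :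
    (C.transport g).e i a = some a' ↔ C.e i (g a) = some (g a') := by
  simp [transport, Option.map_eq_some_iff, Equiv.symm_apply_eq]

lemma transport_transport_symm (C : GLCrystalData k B) (g : A ≃ B) :
    (C.transport g).transport g.symm = C := by
  cases C
  simp [transport, Option.map_map]

lemma SameComponent.transport {C : GLCrystalData k B} (g : A ≃ B) {J : Set (Fin (k - 1))}
    {a a' : A} (h : C.SameComponent J (g a) (g a')) : (C.transport g).SameComponent J a a' := by
  simpa [Function.onFun] using h.of_lowers
    (((C.transport g).equivalence_sameComponent J).comap g.symm)
    fun i hi b b' hb => .rel _ _ ⟨i, hi, (transport_lowers_iff g).2 (by simpa using hb)⟩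

lemma IsSchutzenberger.transport {C : GLCrystalData k B} (g : A ≃ B) {J : Set (Fin (k - 1))}
    {θ : Fin (k - 1) → Fin (k - 1)} {w : Fin k → Fin k} {ξ : B → B}
    (h : C.IsSchutzenberger J θ w ξ) :
    (C.transport g).IsSchutzenberger J θ w (g.symm ∘ ξ ∘ g) where
  component a := .transport g (by simpa using h.component (g a))
  e_comm i hi a := by simp [GLCrystalData.transport, h.e_comm i hi, Function.comp_def]
  f_comm i hi a := by simp [GLCrystalData.transport, h.f_comm i hi, Function.comp_def]
  wt_comm a x := by simp [GLCrystalData.transport, h.wt_comm]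

lemma existsUnique_isSchutzenberger_transport {C : GLCrystalData k B} (g : A ≃ B)
    {J : Set (Fin (k - 1))} {θ : Fin (k - 1) → Fin (k - 1)} {w : Fin k → Fin k}
    (h : ∃! ξ, C.IsSchutzenberger J θ w ξ) :
    ∃! ξ, (C.transport g).IsSchutzenberger J θ w ξ := by
  obtain ⟨ξ, hξ, huniq⟩ := h
  refine ⟨_, hξ.transport g, fun ξ' hξ' => ?_⟩
  have hback := hξ'.transport g.symm
  rw [transport_transport_symm] at hback
  rw [← huniq _ hback]
  funext a
  simp

end Transport

section TensorPower

variable {k r : ℕ} {B : Type} {C : GLCrystalData k B}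

lemma eq_fold_max_iff {ι : Type*} [Fintype ι] {g : ι → ℤ} {s : ι} :
    g s = univ.fold max 0 g ↔ 0 ≤ g s ∧ ∀ u, g u ≤ g s := by
  have hs : g s ≤ univ.fold max 0 g := (le_fold_max _).2 (.inr ⟨s, mem_univ s, le_rfl⟩)
  rw [← hs.ge_iff_eq, fold_max_le]
  simp

lemma tensorEpsAt_eq_iff {i : Fin (k - 1)} {b : Fin r → B} {s : Fin r} :
    C.tensorEpsAt i b s = C.tensorEps i b ↔
      0 ≤ C.tensorEpsAt i b s ∧ ∀ u, C.tensorEpsAt i b u ≤ C.tensorEpsAt i b s :=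
  eq_fold_max_iff

lemma tensorPhiAt_eq_iff {i : Fin (k - 1)} {b : Fin r → B} {s : Fin r} :
    C.tensorPhiAt i b s = C.tensorPhi i b ↔
      0 ≤ C.tensorPhiAt i b s ∧ ∀ u, C.tensorPhiAt i b u ≤ C.tensorPhiAt i b s :=
  eq_fold_max_iff

lemma tensorPower_e_eq_some_iff {i : Fin (k - 1)} {b b' : Fin r → B} :
    (C.tensorPower r).e i b = some b' ↔ ∃ s,
      (0 ≤ C.tensorEpsAt i b s ∧ ∀ u, C.tensorEpsAt i b u ≤ C.tensorEpsAt i b s) ∧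
      (∀ u < s, C.tensorEpsAt i b u < C.tensorEpsAt i b s) ∧
      ∃ c, C.e i (b s) = some c ∧ Function.update b s c = b' := by
  simp only [tensorPower]
  rw [Option.dite_none_right_eq_some]
  simp only [Option.map_eq_some_iff]
  set F := univ.filter fun s => C.tensorEpsAt i b s = C.tensorEps i b
  have hF {s} : s ∈ F ↔ 0 ≤ C.tensorEpsAt i b s ∧
      ∀ u, C.tensorEpsAt i b u ≤ C.tensorEpsAt i b s := by simp [F, tensorEpsAt_eq_iff]
  constructor
  · rintro ⟨hne, h⟩
    have hmax := hF.1 (F.min'_mem hne)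
    refine ⟨_, hmax, fun u hu => (hmax.2 u).lt_of_ne fun heq => ?_, h⟩
    exact hu.not_ge (F.min'_le u (hF.2 (heq ▸ hmax)))
  · rintro ⟨s, hmax, hfirst, h⟩
    have hne : F.Nonempty := ⟨s, hF.2 hmax⟩
    have hs : F.min' hne = s := (F.min'_eq_iff hne s).2
      ⟨hF.2 hmax, fun u hu => not_lt.1 fun hus => ((hF.1 hu).2 s).not_gt (hfirst u hus)⟩
    exact ⟨hne, hs ▸ h⟩

lemma tensorPower_lowers_iff {i : Fin (k - 1)} {b b' : Fin r → B} :
    (C.tensorPower r).Lowers i b b' ↔ ∃ s,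
      (0 ≤ C.tensorPhiAt i b s ∧ ∀ u, C.tensorPhiAt i b u ≤ C.tensorPhiAt i b s) ∧
      (∀ u > s, C.tensorPhiAt i b u < C.tensorPhiAt i b s) ∧
      ∃ c, C.Lowers i (b s) c ∧ Function.update b s c = b' := by
  simp only [Lowers, tensorPower]
  rw [Option.dite_none_right_eq_some]
  simp only [Option.map_eq_some_iff]
  set F := univ.filter fun s => C.tensorPhiAt i b s = C.tensorPhi i b
  have hF {s} : s ∈ F ↔ 0 ≤ C.tensorPhiAt i b s ∧
      ∀ u, C.tensorPhiAt i b u ≤ C.tensorPhiAt i b s := by simp [F, tensorPhiAt_eq_iff]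
  constructor
  · rintro ⟨hne, h⟩
    have hmax := hF.1 (F.max'_mem hne)
    refine ⟨_, hmax, fun u hu => (hmax.2 u).lt_of_ne fun heq => ?_, h⟩
    exact hu.not_ge (F.le_max' u (hF.2 (heq ▸ hmax)))
  · rintro ⟨s, hmax, hlast, h⟩
    have hne : F.Nonempty := ⟨s, hF.2 hmax⟩
    have hs : F.max' hne = s := (F.max'_eq_iff hne s).2
      ⟨hF.2 hmax, fun u hu => not_lt.1 fun hus => ((hF.1 hu).2 s).not_gt (hlast u hus)⟩
    exact ⟨hne, hs ▸ h⟩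

lemma tensorEpsAt_one (C : GLCrystalData k B) (i : Fin (k - 1)) (b : Fin 1 → B) :
    C.tensorEpsAt i b 0 = C.eps i (b 0) := by
  have hIio : (Iio (0 : Fin 1)) = ∅ := by decide
  simp [tensorEpsAt, hIio, corootPairing]

lemma tensorPhiAt_one (C : GLCrystalData k B) (i : Fin (k - 1)) (b : Fin 1 → B) :
    C.tensorPhiAt i b 0 = C.phi i (b 0) := by
  simp [tensorPhiAt, corootPairing]

lemma transport_tensorPower_one (C : GLCrystalData k B) (heps : ∀ i b, 0 ≤ C.eps i b)
    (hphi : ∀ i b, 0 ≤ C.phi i b) :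
    (C.tensorPower 1).transport (Equiv.funUnique (Fin 1) B).symm = C := by
  let T := (C.tensorPower 1).transport (Equiv.funUnique (Fin 1) B).symm
  have he : T.e = C.e := by
    ext i b b'
    simp only [T, transport_e_eq_some_iff, tensorPower_e_eq_some_iff]
    simp [tensorEpsAt_one, heps, funext_iff]
  have hf : T.f = C.f := by
    ext i b b'
    change T.Lowers i b b' ↔ C.Lowers i b b'
    simp only [T, transport_lowers_iff, tensorPower_lowers_iff]
    simp [tensorPhiAt_one, hphi, funext_iff]
  have heps' : T.eps = C.eps := by
    ext i b
    simp [T, transport, tensorPower, tensorEps, tensorEpsAt_one, heps]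
  have hphi' : T.phi = C.phi := by
    ext i b
    simp [T, transport, tensorPower, tensorPhi, tensorPhiAt_one, hphi]
  have hwt : T.wt = C.wt := by
    ext b
    simp [T, transport, tensorPower]
  calc
    T = ⟨T.e, T.f, T.eps, T.phi, T.wt⟩ := rfl
    _ = C := by rw [he, hf, heps', hphi', hwt]

end TensorPower

section IntervalRestriction

/-- The simple root `p + i`, where `[p, p + k)` is an interval of positions of `gl_m`. -/
def shiftRoot {p k m : ℕ} (h : p + k ≤ m) (i : Fin (k - 1)) : Fin (m - 1) := ⟨p + i, by omega⟩

/-- The position `p + a`, where `[p, p + k)` is an interval of positions of `gl_m`. -/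
def shiftPos {p k m : ℕ} (h : p + k ≤ m) (a : Fin k) : Fin m := ⟨p + a, by omega⟩

/-- A comparison of the restriction of a `gl_m`-crystal `C` to the interval of positions
`[p, p + k)` with a `gl_k`-crystal `C'`. An element `b` of `C` consists of its part `get b` inside
the interval, on which the operators of the interval act as in `C'`, and of a remainder, which they
fix; `set b a` is `b` with the part inside the interval replaced by `a`. -/
structure IntervalRestriction {A B : Type} {p k m : ℕ} (h : p + k ≤ m) (C : GLCrystalData m B)
    (C' : GLCrystalData k A) where
  get : B → A
  set : B → A → B
  get_set : ∀ b a, get (set b a) = a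
  set_get : ∀ b, set b (get b) = b
  set_set : ∀ b a a', set (set b a) a' = set b a'
  e_shift : ∀ i b, C.e (shiftRoot h i) b = (C'.e i (get b)).map (set b)
  f_shift : ∀ i b, C.f (shiftRoot h i) b = (C'.f i (get b)).map (set b)
  eps_shift : ∀ i b, C.eps (shiftRoot h i) b = C'.eps i (get b)
  phi_shift : ∀ i b, C.phi (shiftRoot h i) b = C'.phi i (get b)
  wt_shift : ∀ b x, C.wt b (shiftPos h x) = C'.wt (get b) x
  wt_set : ∀ b a y, (∀ x, shiftPos h x ≠ y) → C.wt (set b a) y = C.wt b y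

namespace IntervalRestriction

variable {A B : Type} {p k m : ℕ} {h : p + k ≤ m} {C : GLCrystalData m B} {C' : GLCrystalData k A}

lemma corootPairing_sum_shift (R : IntervalRestriction h C C') {ι : Type*} (i : Fin (k - 1))
    (T : Finset ι) (b : ι → B) :
    corootPairing (shiftRoot h i) (∑ j ∈ T, C.wt (b j)) =
      corootPairing i (∑ j ∈ T, C'.wt (R.get (b j))) := by
  simp only [corootPairing, Finset.sum_apply, ← R.wt_shift]
  rfl

lemma tensorEpsAt_shift (R : IntervalRestriction h C C') {r : ℕ} (i : Fin (k - 1))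
    (b : Fin r → B) :
    C.tensorEpsAt (shiftRoot h i) b = C'.tensorEpsAt i (R.get ∘ b) := by
  funext s
  simp only [tensorEpsAt, R.eps_shift, R.corootPairing_sum_shift, Function.comp_apply]

lemma tensorPhiAt_shift (R : IntervalRestriction h C C') {r : ℕ} (i : Fin (k - 1))
    (b : Fin r → B) :
    C.tensorPhiAt (shiftRoot h i) b = C'.tensorPhiAt i (R.get ∘ b) := by
  funext s
  simp only [tensorPhiAt, R.phi_shift, R.corootPairing_sum_shift, Function.comp_apply]

lemma set_update (R : IntervalRestriction h C C') {r : ℕ} (b : Fin r → B) (s : Fin r) (a : A) :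
    (fun t => R.set (b t) (Function.update (R.get ∘ b) s a t)) =
      Function.update b s (R.set (b s) a) := by
  funext t
  obtain rfl | hts := eq_or_ne t s
  · simp
  · simp [hts, R.set_get]

lemma lowers_shift_iff (R : IntervalRestriction h C C') {i : Fin (k - 1)} {b b' : B} :
    C.Lowers (shiftRoot h i) b b' ↔ ∃ a, C'.Lowers i (R.get b) a ∧ R.set b a = b' := by
  rw [Lowers, R.f_shift, Option.map_eq_some_iff]
  rfl

/-- The restriction of a tensor power, taken factor by factor. -/
def tensorPower (R : IntervalRestriction h C C') (r : ℕ) :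
    IntervalRestriction h (C.tensorPower r) (C'.tensorPower r) where
  get b := R.get ∘ b
  set b a s := R.set (b s) (a s)
  get_set b a := funext fun s => R.get_set (b s) (a s)
  set_get b := funext fun s => R.set_get (b s)
  set_set b a a' := funext fun s => R.set_set (b s) (a s) (a' s)
  e_shift i b := by
    ext b'
    simp only [Option.map_eq_some_iff, tensorPower_e_eq_some_iff, R.tensorEpsAt_shift, R.e_shift]
    simp only [exists_exists_and_eq_and, ← R.set_update, Function.comp_apply]
    constructor
    · rintro ⟨s, hmax, hfirst, a, ha, rfl⟩
      exact ⟨_, ⟨s, hmax, hfirst, a, ha, rfl⟩, rfl⟩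
    · rintro ⟨_, ⟨s, hmax, hfirst, a, ha, rfl⟩, rfl⟩
      exact ⟨s, hmax, hfirst, a, ha, rfl⟩
  f_shift i b := by
    ext b'
    change (C.tensorPower r).Lowers (shiftRoot h i) b b' ↔ _
    have hlowers (a : Fin r → A) : (C'.tensorPower r).f i (R.get ∘ b) = some a ↔ _ :=
      tensorPower_lowers_iff
    simp only [Option.map_eq_some_iff, tensorPower_lowers_iff, hlowers, R.tensorPhiAt_shift,
      R.lowers_shift_iff]
    simp only [exists_exists_and_eq_and, ← R.set_update, Function.comp_apply]
    constructor
    · rintro ⟨s, hmax, hlast, a, ha, rfl⟩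
      exact ⟨_, ⟨s, hmax, hlast, a, ha, rfl⟩, rfl⟩
    · rintro ⟨_, ⟨s, hmax, hlast, a, ha, rfl⟩, rfl⟩
      exact ⟨s, hmax, hlast, a, ha, rfl⟩
  eps_shift i b := by simp only [GLCrystalData.tensorPower, tensorEps, R.tensorEpsAt_shift]
  phi_shift i b := by simp only [GLCrystalData.tensorPower, tensorPhi, R.tensorPhiAt_shift]
  wt_shift b x := by simp [GLCrystalData.tensorPower, R.wt_shift]
  wt_set b a y hy := by simp [GLCrystalData.tensorPower, R.wt_set _ _ _ hy]

variable {p q : Fin m} {h : p.val + k ≤ m} {C : GLCrystalData m B}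

lemma mem_intervalRoots_iff (h : p.val + k ≤ m) (hk : p.val + k = q.val + 1) {i : Fin (m - 1)} :
    i ∈ intervalRoots p q ↔ ∃ j : Fin (k - 1), shiftRoot h j = i := by
  simp only [intervalRoots, shiftRoot, Set.mem_ofPred_eq, Fin.ext_iff]
  exact ⟨fun hi => ⟨⟨i - p, by omega⟩, by simp only; omega⟩, by rintro ⟨j, hj⟩; omega⟩

lemma intervalTheta_shiftRoot (h : p.val + k ≤ m) (hk : p.val + k = q.val + 1)
    (j : Fin (k - 1)) : intervalTheta p q (shiftRoot h j) = shiftRoot h j.rev := by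
  grind [intervalTheta, shiftRoot]

lemma intervalRev_shiftPos (h : p.val + k ≤ m) (hk : p.val + k = q.val + 1) (x : Fin k) :
    intervalRev p q (shiftPos h x) = shiftPos h x.rev := by
  grind [intervalRev, shiftPos]

lemma intervalRev_eq_self (h : p.val + k ≤ m) (hk : p.val + k = q.val + 1) {y : Fin m}
    (hy : ∀ x : Fin k, shiftPos h x ≠ y) : intervalRev p q y = y := by
  refine dif_neg fun hpq => hy ⟨y - p, by omega⟩ (Fin.ext ?_)
  simp only [shiftPos]
  omega

lemma sameComponent_set (R : IntervalRestriction h C C') (hk : p.val + k = q.val + 1) (b : B)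
    {a a' : A} (haa' : C'.Connected a a') :
    C.SameComponent (intervalRoots p q) (R.set b a) (R.set b a') :=
  haa'.of_lowers ((C.equivalence_sameComponent _).comap (R.set b)) fun i _ a a' haa' =>
    .rel _ _ ⟨_, (mem_intervalRoots_iff h hk).2 ⟨i, rfl⟩,
      R.lowers_shift_iff.2 ⟨a', by rwa [R.get_set], R.set_set b a a'⟩⟩

lemma connected_get (R : IntervalRestriction h C C') (hk : p.val + k = q.val + 1) {b b' : B}
    (hbb' : C.SameComponent (intervalRoots p q) b b') : C'.Connected (R.get b) (R.get b') := by
  refine hbb'.of_lowers ((C'.equivalence_sameComponent _).comap R.get) fun i hi b b' hb => ?_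
  obtain ⟨i, rfl⟩ := (mem_intervalRoots_iff h hk).1 hi
  obtain ⟨a, ha, rfl⟩ := R.lowers_shift_iff.1 hb
  simpa only [Function.onFun, R.get_set] using ha.connected

lemma set_eq_of_sameComponent (R : IntervalRestriction h C C') (hk : p.val + k = q.val + 1)
    {b b' : B} (hbb' : C.SameComponent (intervalRoots p q) b b') : R.set b = R.set b' := by
  refine hbb'.of_lowers (eq_equivalence.comap R.set) fun i hi b b' hb => ?_
  obtain ⟨i, rfl⟩ := (mem_intervalRoots_iff h hk).1 hi
  obtain ⟨a, -, rfl⟩ := R.lowers_shift_iff.1 hb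
  exact funext fun a' => (R.set_set b a a').symm

lemma isIntervalSchutzenberger (R : IntervalRestriction h C C') (hk : p.val + k = q.val + 1)
    {ξ : A → A} (hξ : C'.IsFullSchutzenberger ξ) :
    C.IsIntervalSchutzenberger p q fun b => R.set b (ξ (R.get b)) where
  component b := by simpa only [R.set_get] using R.sameComponent_set hk b (hξ.component (R.get b))
  e_comm i hi b := by
    obtain ⟨i, rfl⟩ := (mem_intervalRoots_iff h hk).1 hi
    rw [intervalTheta_shiftRoot h hk, R.e_shift, R.f_shift, R.get_set, hξ.e_comm i trivial]
    simp [Function.comp_def, R.set_set, R.get_set]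
  f_comm i hi b := by
    obtain ⟨i, rfl⟩ := (mem_intervalRoots_iff h hk).1 hi
    rw [intervalTheta_shiftRoot h hk, R.e_shift, R.f_shift, R.get_set, hξ.f_comm i trivial]
    simp [Function.comp_def, R.set_set, R.get_set]
  wt_comm b y := by
    by_cases hy : ∃ x, shiftPos h x = y
    · obtain ⟨x, rfl⟩ := hy
      rw [intervalRev_shiftPos h hk, R.wt_shift, R.wt_shift, R.get_set, hξ.wt_comm]
    · push Not at hy
      rw [intervalRev_eq_self h hk hy, R.wt_set b _ y hy]

lemma isFullSchutzenberger (R : IntervalRestriction h C C') (hk : p.val + k = q.val + 1)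
    {ξ : B → B} (hξ : C.IsIntervalSchutzenberger p q ξ) (b : B) :
    C'.IsFullSchutzenberger fun a => R.get (ξ (R.set b a)) where
  component a := by simpa only [R.get_set] using R.connected_get hk (hξ.component (R.set b a))
  e_comm i _ a := by
    have he := congrArg (Option.map R.get)
      (hξ.e_comm _ ((mem_intervalRoots_iff h hk).2 ⟨i, rfl⟩) (R.set b a))
    rw [intervalTheta_shiftRoot h hk, R.e_shift, R.f_shift, R.get_set] at he
    simpa [Function.comp_def, R.get_set, R.set_set] using he
  f_comm i _ a := by
    have hf := congrArg (Option.map R.get)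
      (hξ.f_comm _ ((mem_intervalRoots_iff h hk).2 ⟨i, rfl⟩) (R.set b a))
    rw [intervalTheta_shiftRoot h hk, R.e_shift, R.f_shift, R.get_set] at hf
    simpa [Function.comp_def, R.get_set, R.set_set] using hf
  wt_comm a x := by
    rw [← R.wt_shift, hξ.wt_comm, intervalRev_shiftPos h hk, R.wt_shift, R.get_set]

lemma existsUnique_isIntervalSchutzenberger (R : IntervalRestriction h C C')
    (hk : p.val + k = q.val + 1) (hC' : ∃! ξ, C'.IsFullSchutzenberger ξ) :
    ∃! ξ, C.IsIntervalSchutzenberger p q ξ := by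
  obtain ⟨ξ, hξ, huniq⟩ := hC'
  refine ⟨_, R.isIntervalSchutzenberger hk hξ, fun ξ' hξ' => funext fun b => ?_⟩
  have hget : R.get (ξ' b) = ξ (R.get b) := by
    simpa only [R.set_get] using congrFun (huniq _ (R.isFullSchutzenberger hk hξ' b)) (R.get b)
  rw [← R.set_get (ξ' b), hget, R.set_eq_of_sameComponent hk (hξ'.component b)]

end IntervalRestriction

end IntervalRestriction

section ExteriorCrystal

variable {k : ℕ}

lemma exteriorCrystal_eps_nonneg (i : Fin (k - 1)) (c : Fin k → Bool) :
    0 ≤ (exteriorCrystal k).eps i c := by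
  simp only [exteriorCrystal]
  split_ifs <;> decide

lemma exteriorCrystal_phi_nonneg (i : Fin (k - 1)) (c : Fin k → Bool) :
    0 ≤ (exteriorCrystal k).phi i c := by
  simp only [exteriorCrystal]
  split_ifs <;> decide

lemma shiftPos_injective {p k m : ℕ} (h : p + k ≤ m) : Function.Injective (shiftPos h) :=
  fun a b hab => Fin.ext (by simpa [shiftPos] using hab)

lemma extend_shiftPos_comp_swap {p k m : ℕ} (h : p + k ≤ m) (c : Fin m → Bool) (x y : Fin k) :
    Function.extend (shiftPos h) ((c ∘ shiftPos h) ∘ Equiv.swap x y) c =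
      c ∘ Equiv.swap (shiftPos h x) (shiftPos h y) := by
  have hinj := shiftPos_injective h
  funext z
  by_cases hz : ∃ w, shiftPos h w = z
  · obtain ⟨w, rfl⟩ := hz
    simp [hinj.extend_apply, hinj.swap_apply]
  · rw [Function.extend_apply' _ _ _ hz, Function.comp_apply, Equiv.swap_apply_of_ne_of_ne]
    · exact fun hx => hz ⟨x, hx.symm⟩
    · exact fun hy => hz ⟨y, hy.symm⟩

/-- The restriction of the `gl_m`-crystal of `0/1`-vectors to an interval: the part of a vector
inside the interval is its subvector there. -/
noncomputable def exteriorRestriction {p k m : ℕ} (h : p + k ≤ m) :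
    IntervalRestriction h (exteriorCrystal m) (exteriorCrystal k) where
  get c := c ∘ shiftPos h
  set c d := Function.extend (shiftPos h) d c
  get_set c d := Function.extend_comp (shiftPos_injective h) d c
  set_get c := by
    classical
    funext y
    by_cases hy : ∃ x, shiftPos h x = y
    · obtain ⟨x, rfl⟩ := hy
      rw [(shiftPos_injective h).extend_apply, Function.comp_apply]
    · rw [Function.extend_apply' _ _ _ hy]
  set_set c d d' := by
    classical
    funext y
    by_cases hy : ∃ x, shiftPos h x = y <;> simp [Function.extend_def, hy]
  e_shift i c := by
    simp only [exteriorCrystal, apply_ite (Option.map _), Option.map_some, Option.map_none,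
      extend_shiftPos_comp_swap]
    rfl
  f_shift i c := by
    simp only [exteriorCrystal, apply_ite (Option.map _), Option.map_some, Option.map_none,
      extend_shiftPos_comp_swap]
    rfl
  eps_shift i c := rfl
  phi_shift i c := rfl
  wt_shift c x := rfl
  wt_set c d y hy := by
    simp only [exteriorCrystal, Function.extend_apply' _ _ _ (not_exists.2 hy)]

end ExteriorCrystal

end GLCrystalData

section Heights

/-- The excess of column `i + 1` over column `i` in the first `t` rows. For the entries of a
`0/1`-matrix the signature rule for the `i`-th operators of the row crystal is expressed through
the points where this function of `t` is maximal. -/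
def rowHeight (x : ℕ → ℕ → ℤ) (i t : ℕ) : ℤ := ∑ s ∈ range t, (x s (i + 1) - x s i)

/-- The excess of row `j` over row `j + 1` in the first `t` columns, which plays the role of
`rowHeight` for the column crystal. -/
def colHeight (x : ℕ → ℕ → ℤ) (j t : ℕ) : ℤ := ∑ k ∈ range t, (x j k - x (j + 1) k)

/-- The last point where `g` is maximal is `s`. -/
def LastMaxAt (g : ℕ → ℤ) (s : ℕ) : Prop := (∀ u ≤ s, g u ≤ g s) ∧ ∀ u > s, g u < g s

/-- The first point where `g` is maximal is `s + 1`. -/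
def FirstMaxAfter (g : ℕ → ℤ) (s : ℕ) : Prop :=
  (∀ u ≤ s, g u < g (s + 1)) ∧ ∀ u > s, g u ≤ g (s + 1)

/-- The change of the entries when a one moves from column `i` to column `i + 1` in row `s`. -/
def rowMove (i s r c : ℕ) : ℤ :=
  if r = s then (if c = i + 1 then 1 else 0) - (if c = i then 1 else 0) else 0

/-- The change of the entries when a one moves from row `j` to row `j + 1` in column `k`. -/
def colMove (j k r c : ℕ) : ℤ :=
  if c = k then (if r = j + 1 then 1 else 0) - (if r = j then 1 else 0) else 0

variable {x : ℕ → ℕ → ℤ} {i j k s : ℕ}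

lemma LastMaxAt.lt {g : ℕ → ℤ} {n s : ℕ} (hs : LastMaxAt g s) (hg : ∀ t ≥ n, g t = g n) :
    s < n := by
  by_contra! hns
  have hlt := hs.2 (s + 1) s.lt_succ_self
  rw [hg s hns, hg (s + 1) (by omega)] at hlt
  exact hlt.false

lemma FirstMaxAfter.lt {g : ℕ → ℤ} {n s : ℕ} (hs : FirstMaxAfter g s)
    (hg : ∀ t ≥ n, g t = g n) : s < n := by
  by_contra! hns
  have hlt := hs.1 s le_rfl
  rw [hg s hns, hg (s + 1) (by omega)] at hlt
  exact hlt.false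

lemma rowHeight_zero (x : ℕ → ℕ → ℤ) (i : ℕ) : rowHeight x i 0 = 0 := sum_range_zero _

lemma colHeight_zero (x : ℕ → ℕ → ℤ) (j : ℕ) : colHeight x j 0 = 0 := sum_range_zero _

lemma rowHeight_succ (x : ℕ → ℕ → ℤ) (i t : ℕ) :
    rowHeight x i (t + 1) = rowHeight x i t + (x t (i + 1) - x t i) := sum_range_succ _ _

lemma colHeight_succ (x : ℕ → ℕ → ℤ) (j t : ℕ) :
    colHeight x j (t + 1) = colHeight x j t + (x j t - x (j + 1) t) := sum_range_succ _ _

lemma rowHeight_add_colMove (x : ℕ → ℕ → ℤ) (i j k t : ℕ) :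
    rowHeight (x + colMove j k) i t = rowHeight x i t +
      if t = j + 1 then (if k = i then 1 else 0) - (if k = i + 1 then 1 else 0) else 0 := by
  induction t with
  | zero => simp [rowHeight_zero]
  | succ t ih =>
    rw [rowHeight_succ, rowHeight_succ, ih]
    simp only [Pi.add_apply, colMove]
    grind

lemma colHeight_add_rowMove (x : ℕ → ℕ → ℤ) (i j s t : ℕ) :
    colHeight (x + rowMove i s) j t = colHeight x j t +
      if t = i + 1 then (if s = j + 1 then 1 else 0) - (if s = j then 1 else 0) else 0 := by
  induction t with
  | zero => simp [colHeight_zero]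
  | succ t ih =>
    rw [colHeight_succ, colHeight_succ, ih]
    simp only [Pi.add_apply, rowMove]
    grind

lemma rowMove_add_colMove (i j : ℕ) :
    rowMove i j + colMove j (i + 1) = colMove j i + rowMove i (j + 1) := by
  funext r c
  simp only [Pi.add_apply, rowMove, colMove]
  grind

/-- A row move and a column move interact only in the square `{j, j + 1} × {i, i + 1}`, and there
only when they start from its upper left or from its lower right corner. -/
lemma lastMaxAt_and_firstMaxAfter_of_ne (hx : ∀ r c, x r c = 0 ∨ x r c = 1)
    (hs : LastMaxAt (rowHeight x i) s) (hk : FirstMaxAfter (colHeight x j) k)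
    (h₁ : ¬ (s = j ∧ k = i)) (h₂ : ¬ (s = j + 1 ∧ k = i + 1)) :
    LastMaxAt (rowHeight (x + colMove j k) i) s ∧
      FirstMaxAfter (colHeight (x + rowMove i s) j) k := by
  have hD := rowHeight_succ x i
  have hE := colHeight_succ x j
  simp only [LastMaxAt, FirstMaxAfter, rowHeight_add_colMove, colHeight_add_rowMove] at *
  generalize rowHeight x i = D at *
  generalize colHeight x j = E at *
  grind

lemma lastMaxAt_and_firstMaxAfter_upper_left (hx : ∀ r c, x r c = 0 ∨ x r c = 1)
    (hs : LastMaxAt (rowHeight x i) j) (hk : FirstMaxAfter (colHeight x j) i) :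
    LastMaxAt (rowHeight (x + colMove j i) i) (j + 1) ∧
      FirstMaxAfter (colHeight (x + rowMove i j) j) (i + 1) := by
  have hD := rowHeight_succ x i
  have hE := colHeight_succ x j
  simp only [LastMaxAt, FirstMaxAfter, rowHeight_add_colMove, colHeight_add_rowMove] at *
  generalize rowHeight x i = D at *
  generalize colHeight x j = E at *
  grind

lemma lastMaxAt_and_firstMaxAfter_lower_right (hx : ∀ r c, x r c = 0 ∨ x r c = 1)
    (hs : LastMaxAt (rowHeight x i) (j + 1)) (hk : FirstMaxAfter (colHeight x j) (i + 1)) :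
    LastMaxAt (rowHeight (x + colMove j (i + 1)) i) j ∧
      FirstMaxAfter (colHeight (x + rowMove i (j + 1)) j) i := by
  have hD := rowHeight_succ x i
  have hE := colHeight_succ x j
  simp only [LastMaxAt, FirstMaxAfter, rowHeight_add_colMove, colHeight_add_rowMove] at *
  generalize rowHeight x i = D at *
  generalize colHeight x j = E at *
  grind

lemma exists_rowMove_add_colMove (hx : ∀ r c, x r c = 0 ∨ x r c = 1)
    (hs : LastMaxAt (rowHeight x i) s) (hk : FirstMaxAfter (colHeight x j) k) :
    ∃ s' k', LastMaxAt (rowHeight (x + colMove j k) i) s' ∧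
      FirstMaxAfter (colHeight (x + rowMove i s) j) k' ∧
      rowMove i s + colMove j k' = colMove j k + rowMove i s' := by
  by_cases h₁ : s = j ∧ k = i
  · obtain ⟨rfl, rfl⟩ := h₁
    obtain ⟨hs', hk'⟩ := lastMaxAt_and_firstMaxAfter_upper_left hx hs hk
    exact ⟨_, _, hs', hk', rowMove_add_colMove _ _⟩
  by_cases h₂ : s = j + 1 ∧ k = i + 1
  · obtain ⟨rfl, rfl⟩ := h₂
    obtain ⟨hs', hk'⟩ := lastMaxAt_and_firstMaxAfter_lower_right hx hs hk
    exact ⟨_, _, hs', hk', by rw [add_comm, ← rowMove_add_colMove, add_comm]⟩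
  · obtain ⟨hs', hk'⟩ := lastMaxAt_and_firstMaxAfter_of_ne hx hs hk h₁ h₂
    exact ⟨_, _, hs', hk', add_comm _ _⟩

end Heights

section Entries

variable {n m : ℕ}

/-- The entries of a `0/1`-matrix as integers, extended by `0` outside the matrix. -/
def entry (M : Matrix (Fin n) (Fin m) Bool) (r c : ℕ) : ℤ :=
  if h : r < n ∧ c < m then (if M ⟨r, h.1⟩ ⟨c, h.2⟩ = true then 1 else 0) else 0

lemma entry_val (M : Matrix (Fin n) (Fin m) Bool) (r : Fin n) (c : Fin m) :
    entry M r c = if M r c = true then 1 else 0 := by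
  simp [entry]

lemma entry_rootLo (M : Matrix (Fin n) (Fin m) Bool) (s : Fin n) (i : Fin (m - 1)) :
    entry M s i = if M s (rootLo i) = true then 1 else 0 := entry_val M s (rootLo i)

lemma entry_rootHi (M : Matrix (Fin n) (Fin m) Bool) (s : Fin n) (i : Fin (m - 1)) :
    entry M s (i + 1) = if M s (rootHi i) = true then 1 else 0 := entry_val M s (rootHi i)

lemma entry_eq_zero_of_row_ge (M : Matrix (Fin n) (Fin m) Bool) {r : ℕ} (hr : n ≤ r) (c : ℕ) :
    entry M r c = 0 := dif_neg fun h => h.1.not_ge hr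

lemma entry_eq_zero_of_col_ge (M : Matrix (Fin n) (Fin m) Bool) (r : ℕ) {c : ℕ} (hc : m ≤ c) :
    entry M r c = 0 := dif_neg fun h => h.2.not_ge hc

lemma entry_eq_zero_or_one (M : Matrix (Fin n) (Fin m) Bool) (r c : ℕ) :
    entry M r c = 0 ∨ entry M r c = 1 := by
  unfold entry
  split_ifs <;> simp

lemma entry_injective : Function.Injective (entry (n := n) (m := m)) := by
  intro M N h
  ext r c
  have hrc := congrFun₂ h r c
  rw [entry_val, entry_val] at hrc
  grind

lemma rowHeight_of_ge (M : Matrix (Fin n) (Fin m) Bool) (i : ℕ) {t : ℕ} (ht : n ≤ t) :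
    rowHeight (entry M) i t = rowHeight (entry M) i n := by
  induction t, ht using Nat.le_induction with
  | base => rfl
  | succ t ht ih => simp [rowHeight_succ, ih, entry_eq_zero_of_row_ge M ht]

lemma colHeight_of_ge (M : Matrix (Fin n) (Fin m) Bool) (j : ℕ) {t : ℕ} (ht : m ≤ t) :
    colHeight (entry M) j t = colHeight (entry M) j m := by
  induction t, ht using Nat.le_induction with
  | base => rfl
  | succ t ht ih => simp [colHeight_succ, ih, entry_eq_zero_of_col_ge M _ ht]

lemma entry_updateRow_swap (M : Matrix (Fin n) (Fin m) Bool) (i : Fin (m - 1)) (s : Fin n) :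
    entry (M.updateRow s (M s ∘ Equiv.swap (rootLo i) (rootHi i))) =
      entry M + (entry M s i - entry M s (i + 1)) • rowMove i s := by
  funext r c
  simp only [Pi.add_apply, Pi.smul_apply, smul_eq_mul, entry_rootLo, entry_rootHi]
  by_cases hrc : r < n ∧ c < m
  · lift r to Fin n using hrc.1
    lift c to Fin m using hrc.2
    have hlo : (c : ℕ) = i ↔ c = rootLo i := by simp [Fin.ext_iff, rootLo]
    have hhi : (c : ℕ) = i + 1 ↔ c = rootHi i := by simp [Fin.ext_iff, rootHi]
    have hne : rootLo i ≠ rootHi i := by simp [Fin.ext_iff, rootLo, rootHi]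
    simp only [entry_val, rowMove, Matrix.updateRow_apply, Fin.val_inj, hlo, hhi,
      Function.comp_apply, Equiv.swap_apply_def]
    grind
  · have := i.isLt
    have := s.isLt
    simp only [entry, dif_neg hrc, rowMove]
    grind

end Entries

section RowOperators

variable {n m : ℕ}

lemma corootPairing_sum_wt (M : Matrix (Fin n) (Fin m) Bool) (i : Fin (m - 1))
    (S : Finset (Fin n)) :
    corootPairing i (∑ j ∈ S, (exteriorCrystal m).wt (rowTensor n m M j)) =
      -∑ j ∈ S.map Fin.valEmbedding, (entry M j (i + 1) - entry M j i) := by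
  simp only [corootPairing, Finset.sum_apply, sum_map, Fin.valEmbedding_apply, entry_rootLo,
    entry_rootHi, ← sum_sub_distrib, ← sum_neg_distrib, neg_sub]
  rfl

lemma tensorEpsAt_rowTensor (M : Matrix (Fin n) (Fin m) Bool) (i : Fin (m - 1)) (s : Fin n) :
    (exteriorCrystal m).tensorEpsAt i (rowTensor n m M) s =
      max (rowHeight (entry M) i s) (rowHeight (entry M) i (s + 1)) := by
  have heps : (exteriorCrystal m).eps i (rowTensor n m M s) =
      max 0 (entry M s (i + 1) - entry M s i) := by
    rw [entry_rootLo, entry_rootHi]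
    change (if M s (rootLo i) = false ∧ M s (rootHi i) = true then (1 : ℤ) else 0) = _
    grind
  rw [GLCrystalData.tensorEpsAt, corootPairing_sum_wt, heps, Fin.map_valEmbedding_Iio,
    Nat.Iio_eq_range, rowHeight_succ]
  change _ - -rowHeight (entry M) i s = _
  omega

lemma tensorPhiAt_rowTensor (M : Matrix (Fin n) (Fin m) Bool) (i : Fin (m - 1)) (s : Fin n) :
    (exteriorCrystal m).tensorPhiAt i (rowTensor n m M) s =
      max (rowHeight (entry M) i s) (rowHeight (entry M) i (s + 1)) -
        rowHeight (entry M) i n := by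
  have hphi : (exteriorCrystal m).phi i (rowTensor n m M s) =
      max 0 (entry M s i - entry M s (i + 1)) := by
    rw [entry_rootLo, entry_rootHi]
    change (if M s (rootLo i) = true ∧ M s (rootHi i) = false then (1 : ℤ) else 0) = _
    grind
  have hIoi : (Ioi s).map Fin.valEmbedding = Ico (s + 1 : ℕ) n := by
    rw [Fin.map_valEmbedding_Ioi]
    rfl
  rw [GLCrystalData.tensorPhiAt, corootPairing_sum_wt, hphi, hIoi,
    sum_Ico_eq_sub _ (Nat.succ_le_of_lt s.isLt)]
  change _ + -(rowHeight (entry M) i n - rowHeight (entry M) i (s + 1)) = _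
  rw [rowHeight_succ]
  omega

lemma isFirstMax_iff_firstMaxAfter {g : ℕ → ℤ} (hg₀ : g 0 = 0) (hg : ∀ t ≥ n, g t = g n)
    {s : Fin n} (hs : g s < g (s + 1)) :
    ((0 ≤ max (g s) (g (s + 1)) ∧ ∀ u : Fin n, max (g u) (g (u + 1)) ≤ max (g s) (g (s + 1))) ∧
      ∀ u < s, max (g u) (g (u + 1)) < max (g s) (g (s + 1))) ↔ FirstMaxAfter g s := by
  rw [max_eq_right hs.le]
  constructor
  · rintro ⟨⟨-, hmax⟩, hfirst⟩
    refine ⟨fun u hu => ?_, fun u _ => ?_⟩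
    · obtain hu | rfl := hu.lt_or_eq
      · exact (le_max_left _ _).trans_lt (hfirst ⟨u, by omega⟩ hu)
      · exact hs
    · obtain hun | hun := lt_or_ge u n
      · exact (le_max_left _ _).trans (hmax ⟨u, hun⟩)
      · have hn := hmax ⟨n - 1, by omega⟩
        grind
  · rintro ⟨hbefore, hafter⟩
    grind

lemma isLastMax_iff_lastMaxAt {g : ℕ → ℤ} (hg : ∀ t ≥ n, g t = g n)
    {s : Fin n} (hs : g (s + 1) < g s) :
    ((0 ≤ max (g s) (g (s + 1)) - g n ∧
        ∀ u : Fin n, max (g u) (g (u + 1)) - g n ≤ max (g s) (g (s + 1)) - g n) ∧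
      ∀ u > s, max (g u) (g (u + 1)) - g n < max (g s) (g (s + 1)) - g n) ↔ LastMaxAt g s := by
  rw [max_eq_left hs.le]
  simp only [sub_nonneg, sub_le_sub_iff_right, sub_lt_sub_iff_right]
  constructor
  · rintro ⟨⟨h0, hmax⟩, hlast⟩
    refine ⟨fun u hu => (le_max_left _ _).trans (hmax ⟨u, by omega⟩), fun u hu => ?_⟩
    obtain hun | hun := lt_or_ge u n
    · exact (le_max_left _ _).trans_lt (hlast ⟨u, hun⟩ hu)
    · obtain hsn | hsn := lt_or_ge (s + 1 : ℕ) n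
      · have hn := hlast ⟨n - 1, by omega⟩ (by rw [gt_iff_lt, Fin.lt_def]; grind)
        grind
      · grind
  · rintro ⟨hbefore, hafter⟩
    grind

lemma exteriorCrystal_e_and_update_iff {i : Fin (m - 1)} {s : Fin n}
    {M M' : Matrix (Fin n) (Fin m) Bool} :
    (∃ c, (exteriorCrystal m).e i (M s) = some c ∧ M.updateRow s c = M') ↔
      rowHeight (entry M) i s < rowHeight (entry M) i (s + 1) ∧
        entry M' = entry M - rowMove i s := by
  have hstep : rowHeight (entry M) i s < rowHeight (entry M) i (s + 1) ↔
      M s (rootLo i) = false ∧ M s (rootHi i) = true := by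
    rw [rowHeight_succ, entry_rootLo, entry_rootHi]
    grind
  simp only [exteriorCrystal, Option.ite_none_right_eq_some, Option.some_inj, hstep, and_assoc,
    exists_and_left, exists_eq_left', and_congr_right_iff]
  intro hlo hhi
  rw [← entry_injective.eq_iff, entry_updateRow_swap, entry_rootLo, entry_rootHi, hlo, hhi, eq_comm]
  simp [sub_eq_add_neg]

lemma exteriorCrystal_lowers_and_update_iff {i : Fin (m - 1)} {s : Fin n}
    {M M' : Matrix (Fin n) (Fin m) Bool} :
    (∃ c, (exteriorCrystal m).Lowers i (M s) c ∧ M.updateRow s c = M') ↔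
      rowHeight (entry M) i (s + 1) < rowHeight (entry M) i s ∧
        entry M' = entry M + rowMove i s := by
  have hstep : rowHeight (entry M) i (s + 1) < rowHeight (entry M) i s ↔
      M s (rootLo i) = true ∧ M s (rootHi i) = false := by
    rw [rowHeight_succ, entry_rootLo, entry_rootHi]
    grind
  simp only [GLCrystalData.Lowers, exteriorCrystal, Option.ite_none_right_eq_some, Option.some_inj,
    hstep, and_assoc, exists_and_left, exists_eq_left', and_congr_right_iff]
  intro hlo hhi
  rw [← entry_injective.eq_iff, entry_updateRow_swap, entry_rootLo, entry_rootHi, hlo, hhi, eq_comm]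
  simp

lemma rowCrystal_e_eq_some_iff {i : Fin (m - 1)} {M M' : Matrix (Fin n) (Fin m) Bool} :
    (rowCrystal n m).e i M = some M' ↔
      ∃ s, FirstMaxAfter (rowHeight (entry M) i) s ∧ entry M' = entry M - rowMove i s := by
  have hg := fun t => rowHeight_of_ge M i (t := t)
  have hmaxiff (s : Fin n) := isFirstMax_iff_firstMaxAfter (rowHeight_zero (entry M) i) hg (s := s)
  rw [rowCrystal, GLCrystalData.transport_e_eq_some_iff, GLCrystalData.tensorPower_e_eq_some_iff]
  simp only [tensorEpsAt_rowTensor]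
  constructor
  · rintro ⟨s, hmax, hfirst, hM'⟩
    obtain ⟨hlt, hM'⟩ := exteriorCrystal_e_and_update_iff.1 hM'
    exact ⟨s, (hmaxiff s hlt).1 ⟨hmax, hfirst⟩, hM'⟩
  · rintro ⟨s, hs, hM'⟩
    have hlt := hs.1 s le_rfl
    have hsn := hs.lt hg
    obtain ⟨hmax, hfirst⟩ := (hmaxiff ⟨s, hsn⟩ hlt).2 hs
    exact ⟨⟨s, hsn⟩, hmax, hfirst, exteriorCrystal_e_and_update_iff.2 ⟨hlt, hM'⟩⟩

lemma rowCrystal_lowers_iff {i : Fin (m - 1)} {M M' : Matrix (Fin n) (Fin m) Bool} :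
    (rowCrystal n m).Lowers i M M' ↔
      ∃ s, LastMaxAt (rowHeight (entry M) i) s ∧ entry M' = entry M + rowMove i s := by
  have hg := fun t => rowHeight_of_ge M i (t := t)
  have hmaxiff (s : Fin n) := isLastMax_iff_lastMaxAt hg (s := s)
  rw [rowCrystal, GLCrystalData.transport_lowers_iff, GLCrystalData.tensorPower_lowers_iff]
  simp only [tensorPhiAt_rowTensor]
  constructor
  · rintro ⟨s, hmax, hlast, hM'⟩
    obtain ⟨hlt, hM'⟩ := exteriorCrystal_lowers_and_update_iff.1 hM'
    exact ⟨s, (hmaxiff s hlt).1 ⟨hmax, hlast⟩, hM'⟩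
  · rintro ⟨s, hs, hM'⟩
    have hlt := hs.2 (s + 1) s.lt_succ_self
    have hsn := hs.lt hg
    obtain ⟨hmax, hlast⟩ := (hmaxiff ⟨s, hsn⟩ hlt).2 hs
    exact ⟨⟨s, hsn⟩, hmax, hlast, exteriorCrystal_lowers_and_update_iff.2 ⟨hlt, hM'⟩⟩

end RowOperators

section Rotation

variable {n m : ℕ}

/-- The rotation of a matrix that turns `c_m ⊗ ⋯ ⊗ c_1` into `r_1 ⊗ ⋯ ⊗ r_m`. -/
def rot : Matrix (Fin n) (Fin m) Bool ≃ Matrix (Fin m) (Fin n) Bool :=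
  (colTensor n m).trans Matrix.of

/-- The `gl_n`-crystal structure on the `n × m` matrices through their columns,
`c_m ⊗ ⋯ ⊗ c_1`. -/
def colCrystal (n m : ℕ) : GLCrystalData n (Matrix (Fin n) (Fin m) Bool) :=
  (rowCrystal m n).transport rot

lemma rot_apply (M : Matrix (Fin n) (Fin m) Bool) (a : Fin m) (b : Fin n) :
    rot M a b = M b a.rev := rfl

lemma rot_rot_apply (M : Matrix (Fin n) (Fin m) Bool) (a : Fin n) (b : Fin m) :
    rot (rot M) a b = M a.rev b.rev := rfl

lemma rot_rot_rot_rot (M : Matrix (Fin n) (Fin m) Bool) : rot (rot (rot (rot M))) = M := by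
  ext a b
  simp [rot_apply]

lemma colCrystal_lowers_iff_rot {j : Fin (n - 1)} {M M' : Matrix (Fin n) (Fin m) Bool} :
    (colCrystal n m).Lowers j M M' ↔ (rowCrystal m n).Lowers j (rot M) (rot M') :=
  GLCrystalData.transport_lowers_iff rot

lemma entry_rot (M : Matrix (Fin n) (Fin m) Bool) (a b : ℕ) :
    entry (rot M) a b = if a < m then entry M b (m - 1 - a) else 0 := by
  by_cases h : a < m
  · have hrev : (⟨a, h⟩ : Fin m).rev = ⟨m - 1 - a, by omega⟩ := by
      ext
      simp only [Fin.val_rev]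
      omega
    have hlt : m - 1 - a < m := by omega
    simp [entry, rot_apply, h, hrev, hlt]
  · simp [entry, h]

lemma rowHeight_rot (M : Matrix (Fin n) (Fin m) Bool) (j t : ℕ) :
    rowHeight (entry (rot M)) j t =
      colHeight (entry M) j (m - t) - colHeight (entry M) j m := by
  induction t with
  | zero => simp [rowHeight_zero]
  | succ t ih =>
    rw [rowHeight_succ, ih, entry_rot, entry_rot]
    by_cases ht : t < m
    · have hmt : m - t = m - (t + 1) + 1 := by omega
      have hmt' : m - 1 - t = m - (t + 1) := by omega
      rw [if_pos ht, if_pos ht, hmt, colHeight_succ, hmt']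
      ring
    · simp [ht, show m - t = m - (t + 1) by omega]

lemma colHeight_rot (M : Matrix (Fin n) (Fin m) Bool) (i : Fin (m - 1)) (t : ℕ) :
    colHeight (entry (rot M)) i t = rowHeight (entry M) i.rev t := by
  have hi := i.isLt
  have hlo : m - 1 - (i : ℕ) = i.rev + 1 := by rw [Fin.val_rev]; omega
  have hhi : m - 1 - (i + 1 : ℕ) = i.rev := by rw [Fin.val_rev]
  refine sum_congr rfl fun k _ => ?_
  rw [entry_rot, entry_rot, if_pos (by omega), if_pos (by omega), hlo, hhi]

lemma lastMaxAt_rot_iff (M : Matrix (Fin n) (Fin m) Bool) (j : ℕ) {s : ℕ} (hs : s < m) :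
    LastMaxAt (rowHeight (entry (rot M)) j) s ↔
      FirstMaxAfter (colHeight (entry M) j) (m - 1 - s) := by
  have hge := fun t => colHeight_of_ge M j (t := t)
  have hms : m - 1 - s + 1 = m - s := by omega
  simp only [LastMaxAt, FirstMaxAfter, rowHeight_rot, hms, sub_le_sub_iff_right,
    sub_lt_sub_iff_right]
  generalize colHeight (entry M) j = g at *
  constructor
  · rintro ⟨hbefore, hafter⟩
    refine ⟨fun u hu => ?_, fun u hu => ?_⟩
    · simpa only [Nat.sub_sub_self (show u ≤ m by omega)] using hafter (m - u) (by omega)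
    · have hu' := hbefore (m - min u m) (by omega)
      grind
  · rintro ⟨hbefore, hafter⟩
    grind

lemma entry_rot_eq_add_rowMove_iff (M M' : Matrix (Fin n) (Fin m) Bool) (j : ℕ) {s : ℕ}
    (hs : s < m) :
    entry (rot M') = entry (rot M) + rowMove j s ↔
      entry M' = entry M + colMove j (m - 1 - s) := by
  simp only [funext_iff, Pi.add_apply, entry_rot, rowMove, colMove]
  constructor
  · intro h r c
    have hc := h (m - 1 - c) r
    have := entry_eq_zero_of_col_ge M r (c := c)
    have := entry_eq_zero_of_col_ge M' r (c := c)
    grind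
  · intro h a b
    have ha := h b (m - 1 - a)
    grind

lemma entry_rot_eq_add_colMove_iff (M M' : Matrix (Fin n) (Fin m) Bool) (i : Fin (m - 1)) (k : ℕ) :
    entry (rot M') = entry (rot M) + colMove i k ↔
      entry M' = entry M - rowMove i.rev k := by
  have hi := i.isLt
  simp only [funext_iff, Pi.add_apply, Pi.sub_apply, entry_rot, rowMove, colMove, Fin.val_rev]
  constructor
  · intro h r c
    have hc := h (m - 1 - c) r
    have := entry_eq_zero_of_col_ge M r (c := c)
    have := entry_eq_zero_of_col_ge M' r (c := c)
    grind
  · intro h a b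
    have ha := h b (m - 1 - a)
    grind

lemma colCrystal_lowers_iff {j : Fin (n - 1)} {M M' : Matrix (Fin n) (Fin m) Bool} :
    (colCrystal n m).Lowers j M M' ↔
      ∃ k, FirstMaxAfter (colHeight (entry M) j) k ∧ entry M' = entry M + colMove j k := by
  rw [colCrystal_lowers_iff_rot, rowCrystal_lowers_iff]
  constructor
  · rintro ⟨s, hs, hM'⟩
    have hsm := hs.lt fun t => rowHeight_of_ge (rot M) j
    exact ⟨_, (lastMaxAt_rot_iff M j hsm).1 hs, (entry_rot_eq_add_rowMove_iff M M' j hsm).1 hM'⟩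
  · rintro ⟨k, hk, hM'⟩
    have hkm := hk.lt fun t => colHeight_of_ge M j
    have hkk : m - 1 - (m - 1 - k) = k := by omega
    exact ⟨m - 1 - k, (lastMaxAt_rot_iff M j (by omega)).2 (by rwa [hkk]),
      (entry_rot_eq_add_rowMove_iff M M' j (by omega)).2 (by rwa [hkk])⟩

lemma rowHeight_add_rowMove (x : ℕ → ℕ → ℤ) (i s t : ℕ) :
    rowHeight (x + rowMove i s) i t = rowHeight x i t + if s < t then 2 else 0 := by
  induction t with
  | zero => simp [rowHeight_zero]
  | succ t ih =>
    rw [rowHeight_succ, rowHeight_succ, ih]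
    simp only [Pi.add_apply, rowMove]
    grind

lemma firstMaxAfter_add_rowMove_iff {M M' : Matrix (Fin n) (Fin m) Bool} {i s : ℕ}
    (hM' : entry M' = entry M + rowMove i s) :
    FirstMaxAfter (rowHeight (entry M') i) s ↔ LastMaxAt (rowHeight (entry M) i) s := by
  have hstep : rowHeight (entry M) i (s + 1) = rowHeight (entry M) i s - 1 := by
    have hlo := congrFun₂ hM' s i
    have hhi := congrFun₂ hM' s (i + 1)
    simp only [Pi.add_apply, rowMove] at hlo hhi
    rw [rowHeight_succ]
    grind [entry_eq_zero_or_one M s i, entry_eq_zero_or_one M' s i,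
      entry_eq_zero_or_one M s (i + 1), entry_eq_zero_or_one M' s (i + 1)]
  simp only [FirstMaxAfter, LastMaxAt, hM', rowHeight_add_rowMove]
  generalize rowHeight (entry M) i = g at *
  grind

lemma isPartialInverse_rowCrystal (n m : ℕ) : (rowCrystal n m).IsPartialInverse := by
  intro i M M'
  rw [rowCrystal_e_eq_some_iff, rowCrystal_lowers_iff]
  refine exists_congr fun s => ?_
  rw [eq_sub_iff_add_eq, eq_comm (b := entry M')]
  exact and_congr_left firstMaxAfter_add_rowMove_iff

lemma rowCrystal_lowers_rot_rot_iff {i : Fin (m - 1)} {M M' : Matrix (Fin n) (Fin m) Bool} :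
    (rowCrystal n m).Lowers i (rot (rot M)) (rot (rot M')) ↔
      (rowCrystal n m).Lowers i.rev M' M := by
  rw [← colCrystal_lowers_iff_rot, colCrystal_lowers_iff, ← isPartialInverse_rowCrystal,
    rowCrystal_e_eq_some_iff]
  simp only [entry_rot_eq_add_colMove_iff, funext (colHeight_rot M i)]

lemma rowCrystal_lowers_iff_rot {i : Fin (m - 1)} {M M' : Matrix (Fin n) (Fin m) Bool} :
    (rowCrystal n m).Lowers i M M' ↔ (colCrystal m n).Lowers i.rev (rot M') (rot M) := by
  rw [colCrystal_lowers_iff_rot, rowCrystal_lowers_rot_rot_iff, Fin.rev_rev]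

end Rotation

section SkewHoweDuality

variable {n m : ℕ}

lemma LastMaxAt.exists_entry_eq {M : Matrix (Fin n) (Fin m) Bool} {i : Fin (m - 1)} {s : ℕ}
    (hs : LastMaxAt (rowHeight (entry M) i) s) :
    ∃ M' : Matrix (Fin n) (Fin m) Bool, entry M' = entry M + rowMove i s := by
  refine ⟨_, (entry_updateRow_swap M i ⟨s, hs.lt fun t => rowHeight_of_ge M i⟩).trans ?_⟩
  have hlt := hs.2 (s + 1) s.lt_succ_self
  rw [rowHeight_succ] at hlt
  have hone : entry M s i - entry M s (i + 1) = 1 := by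
    grind [entry_eq_zero_or_one M s i, entry_eq_zero_or_one M s (i + 1)]
  rw [hone, one_smul]

lemma diamond_rowCrystal_colCrystal (i : Fin (m - 1)) (j : Fin (n - 1)) :
    Diamond ((rowCrystal n m).Lowers i) ((colCrystal n m).Lowers j) := by
  intro M b c hb hc
  obtain ⟨s, hs, hbM⟩ := rowCrystal_lowers_iff.1 hb
  obtain ⟨k, hk, hcM⟩ := colCrystal_lowers_iff.1 hc
  obtain ⟨s', k', hs', hk', hcomm⟩ := exists_rowMove_add_colMove (entry_eq_zero_or_one M) hs hk
  rw [← hcM] at hs'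
  rw [← hbM] at hk'
  obtain ⟨d, hd⟩ := hs'.exists_entry_eq
  refine ⟨d, colCrystal_lowers_iff.2 ⟨k', hk', ?_⟩, rowCrystal_lowers_iff.2 ⟨s', hs', hd⟩⟩
  rw [hd, hbM, hcM, add_assoc, add_assoc, hcomm]

/-- The square for the two lowering operators, applied to the rotations of a matrix, gives the
squares which involve raising operators. -/
lemma commute_rowCrystal_colCrystal (n m : ℕ) : (rowCrystal n m).Commute (colCrystal n m) := by
  have raises_lowers (n m) (i : Fin (m - 1)) (j : Fin (n - 1)) :
      Diamond (flip ((rowCrystal n m).Lowers i)) ((colCrystal n m).Lowers j) := by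
    have h := (diamond_rowCrystal_colCrystal j i.rev).symm.comap (rot (n := n) (m := m)).surjective
    simp only [← rowCrystal_lowers_iff_rot, ← colCrystal_lowers_iff_rot] at h
    exact h
  have raises_raises (n m) (i : Fin (m - 1)) (j : Fin (n - 1)) :
      Diamond (flip ((rowCrystal n m).Lowers i)) (flip ((colCrystal n m).Lowers j)) := by
    have h := (raises_lowers m n j i.rev).symm.comap (rot (n := n) (m := m)).surjective
    simp only [flip, ← rowCrystal_lowers_iff_rot, ← colCrystal_lowers_iff_rot] at h
    exact h
  have lowers_raises (n m) (i : Fin (m - 1)) (j : Fin (n - 1)) :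
      Diamond ((rowCrystal n m).Lowers i) (flip ((colCrystal n m).Lowers j)) := by
    have h := (raises_raises m n j i.rev).symm.comap (rot (n := n) (m := m)).surjective
    simp only [flip, ← rowCrystal_lowers_iff_rot, ← colCrystal_lowers_iff_rot] at h
    exact h
  exact ⟨diamond_rowCrystal_colCrystal, lowers_raises n m, raises_lowers n m, raises_raises n m⟩

end SkewHoweDuality

section Components

variable {n m : ℕ}

lemma sum_mul_rowMove (w : ℕ → ℤ) (i : Fin (m - 1)) (s r : ℕ) :
    ∑ c ∈ range m, w c * rowMove i s r c = if r = s then w (i + 1) - w i else 0 := by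
  have hlo : (i : ℕ) ∈ range m := by simp; omega
  have hhi : (i + 1 : ℕ) ∈ range m := by simp; omega
  split_ifs with hr
  · simp only [rowMove, if_pos hr, mul_sub, mul_ite, mul_one, mul_zero, sum_sub_distrib,
      sum_ite_eq', hlo, hhi, if_true]
  · simp [rowMove, hr]

/-- The sum of the column indices of the ones of a matrix. Every lowering operator of the row
crystal increases it by one. -/
def colIndexSum (M : Matrix (Fin n) (Fin m) Bool) : ℤ :=
  ∑ r ∈ range n, ∑ c ∈ range m, c * entry M r c

lemma colIndexSum_nonneg (M : Matrix (Fin n) (Fin m) Bool) : 0 ≤ colIndexSum M := by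
  refine sum_nonneg fun r _ => sum_nonneg fun c _ => mul_nonneg c.cast_nonneg ?_
  obtain h | h := entry_eq_zero_or_one M r c <;> simp [h]

lemma colIndexSum_of_lowers {i : Fin (m - 1)} {M M' : Matrix (Fin n) (Fin m) Bool}
    (h : (rowCrystal n m).Lowers i M M') : colIndexSum M' = colIndexSum M + 1 := by
  obtain ⟨s, hs, hM'⟩ := rowCrystal_lowers_iff.1 h
  have hsn : s ∈ range n := mem_range.2 (hs.lt fun t => rowHeight_of_ge M i)
  simp only [colIndexSum, hM', Pi.add_apply, mul_add, sum_add_distrib, sum_mul_rowMove,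
    sum_ite_eq', hsn, if_true]
  push_cast
  ring

lemma raisingTerminates_rowCrystal (n m : ℕ) : (rowCrystal n m).RaisingTerminates := by
  refine Subrelation.wf ?_ (measure fun M => (colIndexSum M).toNat).wf
  rintro M' M ⟨i, h⟩
  have := colIndexSum_of_lowers h
  have := colIndexSum_nonneg M'
  change (colIndexSum M').toNat < (colIndexSum M).toNat
  omega

lemma loweringTerminates_rowCrystal (n m : ℕ) : (rowCrystal n m).LoweringTerminates := by
  refine Subrelation.wf ?_ (InvImage.wf (rot ∘ rot) (raisingTerminates_rowCrystal n m))
  rintro M' M ⟨i, h⟩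
  exact ⟨i.rev, rowCrystal_lowers_rot_rot_iff.2 (by rwa [Fin.rev_rev])⟩

lemma raisingTerminates_colCrystal (n m : ℕ) : (colCrystal n m).RaisingTerminates := by
  refine Subrelation.wf ?_ (InvImage.wf rot (raisingTerminates_rowCrystal m n))
  rintro M' M ⟨j, h⟩
  exact ⟨j, colCrystal_lowers_iff_rot.1 h⟩

lemma colCrystal_connected_rot {M M' : Matrix (Fin n) (Fin m) Bool}
    (h : (rowCrystal n m).Connected M M') : (colCrystal m n).Connected (rot M) (rot M') :=
  h.of_lowers (((colCrystal m n).equivalence_sameComponent _).comap rot) fun _ _ _ _ hM =>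
    .symm _ _ (GLCrystalData.Lowers.connected (rowCrystal_lowers_iff_rot.1 hM))

lemma rowCrystal_connected_rot {M M' : Matrix (Fin n) (Fin m) Bool}
    (h : (colCrystal n m).Connected M M') : (rowCrystal m n).Connected (rot M) (rot M') :=
  h.of_lowers (((rowCrystal m n).equivalence_sameComponent _).comap rot) fun _ _ _ _ hM =>
    GLCrystalData.Lowers.connected (colCrystal_lowers_iff_rot.1 hM)

lemma rowCrystal_isHighest_rot_iff {M : Matrix (Fin n) (Fin m) Bool} :
    (rowCrystal m n).IsHighest (rot M) ↔ (colCrystal n m).IsHighest M :=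
  forall_congr' fun _ => rot.surjective.forall.trans
    (forall_congr' fun _ => not_congr colCrystal_lowers_iff_rot.symm)

lemma colCrystal_isHighest_rot_iff {M : Matrix (Fin n) (Fin m) Bool} :
    (colCrystal m n).IsHighest (rot M) ↔ (rowCrystal n m).IsLowest M :=
  (Fin.revPerm.forall_congr_left).trans <| forall_congr' fun _ => rot.surjective.forall.trans
    (forall_congr' fun _ => not_congr rowCrystal_lowers_iff_rot.symm)

lemma rowCrystal_wt_apply (M : Matrix (Fin n) (Fin m) Bool) (c : Fin m) :
    (rowCrystal n m).wt M c = ∑ r, if M r c = true then 1 else 0 := by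
  simp [rowCrystal, GLCrystalData.transport, GLCrystalData.tensorPower, exteriorCrystal, rowTensor,
    -sum_boole]
  rfl

lemma colCrystal_wt_apply (M : Matrix (Fin n) (Fin m) Bool) (r : Fin n) :
    (colCrystal n m).wt M r = ∑ c, if M r c = true then 1 else 0 :=
  (rowCrystal_wt_apply (rot M) r).trans <|
    Equiv.sum_comp Fin.revPerm fun c => if M r c = true then (1 : ℤ) else 0

lemma rowCrystal_wt_rot_rot (M : Matrix (Fin n) (Fin m) Bool) (c : Fin m) :
    (rowCrystal n m).wt (rot (rot M)) c = (rowCrystal n m).wt M c.rev := by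
  simp only [rowCrystal_wt_apply, rot_rot_apply]
  exact Equiv.sum_comp Fin.revPerm fun r => if M r c.rev = true then (1 : ℤ) else 0

lemma colCrystal_wt_of_connected {M M' : Matrix (Fin n) (Fin m) Bool}
    (h : (rowCrystal n m).Connected M M') : (colCrystal n m).wt M = (colCrystal n m).wt M' := by
  refine h.of_lowers (eq_equivalence.comap _) fun i _ M M' hM => ?_
  obtain ⟨s, -, hM'⟩ := rowCrystal_lowers_iff.1 hM
  funext r
  have hsum (N : Matrix (Fin n) (Fin m) Bool) :
      (colCrystal n m).wt N r = ∑ c ∈ range m, entry N r c := by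
    simp only [colCrystal_wt_apply, ← entry_val, Fin.sum_univ_eq_sum_range (entry N r)]
  have hmove : ∑ c ∈ range m, rowMove i s r c = 0 := by simpa using sum_mul_rowMove 1 i s r
  rw [hsum, hsum, hM']
  simp [sum_add_distrib, hmove]

lemma rowCrystal_wt_of_connected {M M' : Matrix (Fin n) (Fin m) Bool}
    (h : (colCrystal n m).Connected M M') : (rowCrystal n m).wt M = (rowCrystal n m).wt M' := by
  have hrot := colCrystal_wt_of_connected (rowCrystal_connected_rot h)
  funext c
  have hc := congrFun hrot c.rev
  simpa only [colCrystal_wt_apply, rowCrystal_wt_apply, rot_apply, Fin.rev_rev] using hc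

end Components

section HighestWeight

variable {n m : ℕ}

lemma exists_firstMaxAfter {g : ℕ → ℤ} (hg₀ : g 0 = 0) (hg : ∀ t ≥ n, g t = g n) {t : ℕ}
    (ht : 0 < g t) : ∃ s, FirstMaxAfter g s := by
  have hmax : ∃ s, ∀ u, g u ≤ g s := by
    obtain ⟨s, -, hs⟩ := exists_max_image (range (n + 1)) g ⟨0, by simp⟩
    simp only [mem_range] at hs
    refine ⟨s, fun u => ?_⟩
    obtain hun | hun := lt_or_ge u n
    · exact hs u (by omega)
    · exact (hg u hun).trans_le (hs n n.lt_succ_self)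
  classical
  obtain ⟨s, hmax, hfirst⟩ : ∃ s, (∀ u, g u ≤ g s) ∧ ∀ u < s, ¬ ∀ v, g v ≤ g u :=
    ⟨Nat.find hmax, Nat.find_spec hmax, fun _ => Nat.find_min hmax⟩
  obtain ⟨s, rfl⟩ : ∃ s', s = s' + 1 :=
    Nat.exists_eq_succ_of_ne_zero (by rintro rfl; have := hmax t; omega)
  refine ⟨s, fun u hu => ?_, fun u _ => hmax u⟩
  obtain ⟨v, hv⟩ := not_forall.1 (hfirst u (by omega))
  exact (not_le.1 hv).trans_le (hmax v)

lemma FirstMaxAfter.exists_entry_eq {M : Matrix (Fin n) (Fin m) Bool} {i : Fin (m - 1)} {s : ℕ}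
    (hs : FirstMaxAfter (rowHeight (entry M) i) s) :
    ∃ M' : Matrix (Fin n) (Fin m) Bool, entry M' = entry M - rowMove i s := by
  refine ⟨_, (entry_updateRow_swap M i ⟨s, hs.lt fun t => rowHeight_of_ge M i⟩).trans ?_⟩
  have hlt := hs.1 s le_rfl
  rw [rowHeight_succ] at hlt
  have hone : entry M s i - entry M s (i + 1) = -1 := by
    grind [entry_eq_zero_or_one M s i, entry_eq_zero_or_one M s (i + 1)]
  rw [hone, neg_one_smul, sub_eq_add_neg]

lemma rowHeight_nonpos_of_isHighest {M : Matrix (Fin n) (Fin m) Bool}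
    (hM : (rowCrystal n m).IsHighest M) (i t : ℕ) : rowHeight (entry M) i t ≤ 0 := by
  obtain hi | hi := lt_or_ge i (m - 1)
  · by_contra! ht
    obtain ⟨s, hs⟩ := exists_firstMaxAfter (rowHeight_zero _ i)
      (fun t ht => rowHeight_of_ge M i ht) ht
    obtain ⟨M', hM'⟩ := FirstMaxAfter.exists_entry_eq (i := ⟨i, hi⟩) hs
    exact hM ⟨i, hi⟩ M' <| (isPartialInverse_rowCrystal n m _ _ _).1 <|
      rowCrystal_e_eq_some_iff.2 ⟨s, hs, hM'⟩
  · refine sum_nonpos fun r _ => ?_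
    have := entry_eq_zero_of_col_ge M r (c := i + 1) (by omega)
    have := entry_eq_zero_or_one M r i
    omega

lemma colHeight_le_of_isHighest {M : Matrix (Fin n) (Fin m) Bool}
    (hM : (colCrystal n m).IsHighest M) (j t : ℕ) :
    colHeight (entry M) j t ≤ colHeight (entry M) j m := by
  obtain ht | ht := le_total t m
  · have h := rowHeight_nonpos_of_isHighest (rowCrystal_isHighest_rot_iff.2 hM) j (m - t)
    rwa [rowHeight_rot, Nat.sub_sub_self ht, sub_nonpos] at h
  · exact (colHeight_of_ge M j ht).le

lemma antitone_rows_and_cols {x : ℕ → ℕ → ℤ} (hx : ∀ r c, x r c = 0 ∨ x r c = 1)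
    (hxm : ∀ r, ∀ c ≥ m, x r c = 0) (hrow : ∀ i t, rowHeight x i t ≤ 0)
    (hcol : ∀ j t, colHeight x j t ≤ colHeight x j m) :
    (∀ r, Antitone (x r)) ∧ ∀ c, Antitone fun r => x r c := by
  have row_step {r c} (hc : Antitone fun r => x r (c + 1)) : x r (c + 1) ≤ x r c := by
    by_contra! h
    have hpos : 0 < rowHeight x c (r + 1) := by
      refine sum_pos' (fun s hs => ?_) ⟨r, self_mem_range_succ r, sub_pos.2 h⟩
      have := hc (mem_range_succ_iff.1 hs)
      grind
    exact (hrow c (r + 1)).not_gt hpos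
  have col_step {r c} (hr : ∀ k ≥ c, x r (k + 1) ≤ x r k) : x (r + 1) c ≤ x r c := by
    by_contra! h
    have hcm : c < m := by grind
    have hneg : ∑ k ∈ Ico c m, (x r k - x (r + 1) k) < 0 := by
      refine sum_neg' (fun k hk => ?_) ⟨c, by simpa using hcm, sub_neg.2 h⟩
      have hk : x r k ≤ x r c := by
        refine Nat.le_induction le_rfl (fun k hk ih => (hr k hk).trans ih) k (mem_Ico.1 hk).1
      grind
    rw [sum_Ico_eq_sub _ hcm.le] at hneg
    exact (hcol r c).not_gt (sub_neg.1 hneg)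
  have steps (c : ℕ) : (∀ r, ∀ k ≥ c, x r (k + 1) ≤ x r k) ∧ Antitone fun r => x r c := by
    obtain hcm | hcm := le_total m c
    · exact ⟨by grind, by simp [hxm _ c hcm, antitone_const]⟩
    induction hcm using Nat.decreasingInduction with
    | self => exact ⟨by grind, by simp [hxm _ m le_rfl, antitone_const]⟩
    | of_succ c _ ih =>
      obtain ⟨ihr, ihc⟩ := ih
      have hr : ∀ r, ∀ k ≥ c, x r (k + 1) ≤ x r k := fun r k hk => by
        obtain rfl | hk := hk.eq_or_lt
        · exact row_step ihc
        · exact ihr r k hk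
      exact ⟨hr, antitone_nat_of_succ_le fun r => col_step (hr r)⟩
  exact ⟨fun r => antitone_nat_of_succ_le fun c => (steps 0).1 r c c.zero_le, fun c => (steps c).2⟩

/-- A matrix of highest weight for both crystal structures; such matrices are representatives of
the bicomponents. -/
def IsBihighest (M : Matrix (Fin n) (Fin m) Bool) : Prop :=
  (rowCrystal n m).IsHighest M ∧ (colCrystal n m).IsHighest M

lemma IsBihighest.antitone {M : Matrix (Fin n) (Fin m) Bool} (hM : IsBihighest M) :
    (∀ r, Antitone (M r)) ∧ ∀ c, Antitone fun r => M r c := by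
  obtain ⟨hr, hc⟩ := antitone_rows_and_cols (entry_eq_zero_or_one M)
    (fun r c => entry_eq_zero_of_col_ge M r) (rowHeight_nonpos_of_isHighest hM.1)
    (colHeight_le_of_isHighest hM.2)
  have le_iff {r r' : Fin n} {c c' : Fin m} : entry M r c ≤ entry M r' c' → M r c ≤ M r' c' := by
    rw [entry_val, entry_val]
    cases M r c <;> cases M r' c' <;> simp
  exact ⟨fun r c c' h => le_iff (hr r h), fun c r r' h => le_iff (hc c h)⟩

lemma eq_of_antitone_of_sum_eq {ι : Type*} [Fintype ι] [LinearOrder ι] {f g : ι → Bool}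
    (hf : Antitone f) (hg : Antitone g)
    (h : ∑ a, (if f a = true then (1 : ℤ) else 0) = ∑ a, if g a = true then 1 else 0) :
    f = g := by
  have eq_of_le {f g : ι → Bool} (hfg : f ≤ g)
      (h : ∑ a, (if f a = true then (1 : ℤ) else 0) = ∑ a, if g a = true then 1 else 0) :
      f = g := by
    have hle (a : ι) : (if f a = true then (1 : ℤ) else 0) ≤ if g a = true then 1 else 0 := by
      have := hfg a
      revert this
      cases f a <;> cases g a <;> simp
    funext a
    have := (sum_eq_sum_iff_of_le fun a _ => hle a).1 h a (mem_univ a)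
    revert this
    cases f a <;> cases g a <;> simp
  have hcomp : f ≤ g ∨ g ≤ f := by
    by_contra! hfg
    simp only [Pi.le_def, not_forall, not_le, Bool.lt_iff] at hfg
    obtain ⟨⟨a, hga, hfa⟩, b, hfb, hgb⟩ := hfg
    obtain hab | hba := le_total a b
    · exact absurd (hg hab) (by rw [hga, hgb]; decide)
    · exact absurd (hf hba) (by rw [hfa, hfb]; decide)
  exact hcomp.elim (eq_of_le · h) fun hgf => (eq_of_le hgf h.symm).symm

lemma IsBihighest.eq_of_connected {T T' : Matrix (Fin n) (Fin m) Bool} (hT : IsBihighest T)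
    (hT' : IsBihighest T') (h : (rowCrystal n m).Connected T T') : T = T' := by
  funext r
  refine eq_of_antitone_of_sum_eq (hT.antitone.1 r) (hT'.antitone.1 r) ?_
  simpa only [colCrystal_wt_apply] using congrFun (colCrystal_wt_of_connected h) r

lemma rowCrystal_eq_of_isHighest {M M' : Matrix (Fin n) (Fin m) Bool}
    (hM : (rowCrystal n m).IsHighest M) (hM' : (rowCrystal n m).IsHighest M')
    (h : (rowCrystal n m).Connected M M') : M = M' :=
  (commute_rowCrystal_colCrystal n m).eq_of_isHighest (raisingTerminates_colCrystal n m)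
    (fun _ _ hb hDb hb' hDb' => IsBihighest.eq_of_connected ⟨hb, hDb⟩ ⟨hb', hDb'⟩) hM hM' h

lemma eq_of_connected_of_connected {M M' : Matrix (Fin n) (Fin m) Bool}
    (hrow : (rowCrystal n m).Connected M M') (hcol : (colCrystal n m).Connected M M') : M = M' :=
  (commute_rowCrystal_colCrystal n m).eq_of_connected (raisingTerminates_rowCrystal n m)
    (fun _ _ => rowCrystal_eq_of_isHighest) hrow hcol

end HighestWeight

section Evacuation

variable {n m : ℕ}

/-- Two matrices lie in the same component for the two commuting crystal structures together. -/
def SameBicomponent (M M' : Matrix (Fin n) (Fin m) Bool) : Prop :=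
  Comp (rowCrystal n m).Connected (colCrystal n m).Connected M M'

lemma equivalence_sameBicomponent (n m : ℕ) :
    Equivalence (SameBicomponent (n := n) (m := m)) :=
  (commute_rowCrystal_colCrystal n m).equivalence_comp_connected

lemma exists_isBihighest (M : Matrix (Fin n) (Fin m) Bool) :
    ∃ T, IsBihighest T ∧ SameBicomponent M T := by
  obtain ⟨M', hMM', hrow⟩ := (raisingTerminates_rowCrystal n m).exists_isHighest M
  obtain ⟨T, hM'T, hcol⟩ := (raisingTerminates_colCrystal n m).exists_isHighest M'
  have hcomm := (commute_rowCrystal_colCrystal n m).symm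
  exact ⟨T, ⟨hcomm.isHighest_of_connected hM'T hrow, hcol⟩, M', hMM', hM'T⟩

lemma SameBicomponent.rot_rot {M M' : Matrix (Fin n) (Fin m) Bool} (h : SameBicomponent M M') :
    SameBicomponent (rot (rot M)) (rot (rot M')) :=
  let ⟨N, hrow, hcol⟩ := h
  ⟨rot (rot N), rowCrystal_connected_rot (colCrystal_connected_rot hrow),
    colCrystal_connected_rot (rowCrystal_connected_rot hcol)⟩

lemma IsBihighest.exists_connected_rot_eq_transpose {T : Matrix (Fin n) (Fin m) Bool}
    (hT : IsBihighest T) :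
    IsBihighest T.transpose ∧ ∃ L, (rowCrystal n m).Connected T L ∧ rot L = T.transpose := by
  obtain ⟨L, hTL, hL⟩ := (loweringTerminates_rowCrystal n m).exists_isLowest T
  have hrot : IsBihighest (rot L) :=
    ⟨rowCrystal_isHighest_rot_iff.2
      ((commute_rowCrystal_colCrystal n m).isHighest_of_connected hTL hT.2),
      colCrystal_isHighest_rot_iff.2 hL⟩
  have heq : rot L = T.transpose := by
    suffices hrows : ∀ r, (fun c => rot L c r) = T r from funext fun c => funext fun r =>
      congrFun (hrows r) c
    intro r
    refine eq_of_antitone_of_sum_eq (hrot.antitone.2 r) (hT.antitone.1 r) ?_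
    have hsum := congrFun (colCrystal_wt_of_connected hTL) r
    rw [colCrystal_wt_apply, colCrystal_wt_apply] at hsum
    rw [hsum]
    exact Equiv.sum_comp Fin.revPerm fun c => if L r c = true then (1 : ℤ) else 0
  exact ⟨heq ▸ hrot, L, hTL, heq⟩

lemma IsBihighest.sameBicomponent_rot_rot {T : Matrix (Fin n) (Fin m) Bool}
    (hT : IsBihighest T) : SameBicomponent T (rot (rot T)) := by
  obtain ⟨hT', L, hTL, hL⟩ := hT.exists_connected_rot_eq_transpose
  obtain ⟨-, L', hTL', hL'⟩ := hT'.exists_connected_rot_eq_transpose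
  have hcol : (colCrystal n m).Connected (rot (rot L)) T := by
    simpa only [hL, hL', Matrix.transpose_transpose] using colCrystal_connected_rot hTL'
  have hrow : (rowCrystal n m).Connected (rot (rot L)) (rot (rot T)) :=
    rowCrystal_connected_rot (colCrystal_connected_rot (.symm _ _ hTL))
  exact (equivalence_sameBicomponent n m).trans ⟨T, .refl T, .symm _ _ hcol⟩
    ⟨_, hrow, .refl _⟩

lemma sameBicomponent_rot_rot (M : Matrix (Fin n) (Fin m) Bool) :
    SameBicomponent M (rot (rot M)) := by
  have h := equivalence_sameBicomponent n m
  obtain ⟨T, hT, hMT⟩ := exists_isBihighest M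
  exact h.trans hMT (h.trans hT.sameBicomponent_rot_rot (h.symm hMT).rot_rot)

/-- The Schützenberger involution of the `gl_m`-crystal of matrices, constructed as the unique
common point of the row component of `M` and of the column component of `rot (rot M)`. -/
noncomputable def evac (M : Matrix (Fin n) (Fin m) Bool) : Matrix (Fin n) (Fin m) Bool :=
  (sameBicomponent_rot_rot M).choose

lemma rowCrystal_connected_evac (M : Matrix (Fin n) (Fin m) Bool) :
    (rowCrystal n m).Connected M (evac M) :=
  (sameBicomponent_rot_rot M).choose_spec.1

lemma colCrystal_connected_evac_rot_rot (M : Matrix (Fin n) (Fin m) Bool) :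
    (colCrystal n m).Connected (evac M) (rot (rot M)) :=
  (sameBicomponent_rot_rot M).choose_spec.2

lemma evac_eq {M E : Matrix (Fin n) (Fin m) Bool} (hrow : (rowCrystal n m).Connected M E)
    (hcol : (colCrystal n m).Connected E (rot (rot M))) : evac M = E :=
  eq_of_connected_of_connected
    (.trans _ _ _ (.symm _ _ (rowCrystal_connected_evac M)) hrow)
    (.trans _ _ _ (colCrystal_connected_evac_rot_rot M) (.symm _ _ hcol))

lemma evac_rot_rot_rot (M : Matrix (Fin n) (Fin m) Bool) :
    evac (rot (rot (rot M))) = rot (evac M) := by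
  refine evac_eq (.symm _ _ (rowCrystal_connected_rot (colCrystal_connected_evac_rot_rot M))) ?_
  rw [rot_rot_rot_rot]
  exact .symm _ _ (colCrystal_connected_rot (rowCrystal_connected_evac M))

lemma isFullSchutzenberger_evac (n m : ℕ) : (rowCrystal n m).IsFullSchutzenberger evac :=
  (commute_rowCrystal_colCrystal n m).isFullSchutzenberger (isPartialInverse_rowCrystal n m)
    (fun _ _ => eq_of_connected_of_connected) (rot.trans rot).surjective
    (fun _ _ _ => rowCrystal_lowers_rot_rot_iff) rowCrystal_wt_rot_rot
    (fun _ _ => rowCrystal_wt_of_connected) rowCrystal_connected_evac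
    colCrystal_connected_evac_rot_rot

lemma existsUnique_isFullSchutzenberger_rowCrystal (n m : ℕ) :
    ∃! ξ, (rowCrystal n m).IsFullSchutzenberger ξ :=
  ⟨evac, isFullSchutzenberger_evac n m, fun _ hξ =>
    hξ.eq (isPartialInverse_rowCrystal n m) (loweringTerminates_rowCrystal n m)
      (fun _ _ => rowCrystal_eq_of_isHighest) (isFullSchutzenberger_evac n m)⟩

end Evacuation

section CactusActions

open GLCrystalData

variable {n m K : ℕ}

lemma tensorPower_exteriorCrystal (n m : ℕ) :
    (exteriorCrystal m).tensorPower n = (rowCrystal n m).transport (rowTensor n m).symm :=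
  (transport_transport_symm _ (rowTensor n m)).symm

lemma existsUnique_isFullSchutzenberger_tensorPower (n m : ℕ) :
    ∃! ξ, ((exteriorCrystal m).tensorPower n).IsFullSchutzenberger ξ := by
  rw [tensorPower_exteriorCrystal]
  exact existsUnique_isSchutzenberger_transport _ (existsUnique_isFullSchutzenberger_rowCrystal n m)

lemma isFullSchutzenberger_tensorPower (n m : ℕ) :
    ((exteriorCrystal m).tensorPower n).IsFullSchutzenberger
      (rowTensor n m ∘ evac ∘ (rowTensor n m).symm) := by
  rw [tensorPower_exteriorCrystal]
  exact (isFullSchutzenberger_evac n m).transport (rowTensor n m).symm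

lemma schutzenberger_rowTensor (M : Matrix (Fin n) (Fin m) Bool) :
    ((exteriorCrystal m).tensorPower n).schutzenberger (rowTensor n m M) =
      rowTensor n m (evac M) := by
  rw [schutzenberger_eq (existsUnique_isFullSchutzenberger_tensorPower n m)
    (isFullSchutzenberger_tensorPower n m)]
  rfl

lemma existsUnique_isFullSchutzenberger_exteriorCrystal (k : ℕ) :
    ∃! ξ, (exteriorCrystal k).IsFullSchutzenberger ξ := by
  rw [← transport_tensorPower_one _ exteriorCrystal_eps_nonneg exteriorCrystal_phi_nonneg]
  exact existsUnique_isSchutzenberger_transport _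
    (existsUnique_isFullSchutzenberger_tensorPower 1 k)

lemma schutzenberger_exteriorCrystal {k : ℕ} (c : Fin k → Bool) :
    (exteriorCrystal k).schutzenberger c = c ∘ Fin.rev := by
  have huniq := existsUnique_isFullSchutzenberger_exteriorCrystal k
  obtain ⟨ξ, hξ⟩ := huniq.exists
  rw [schutzenberger_eq huniq hξ]
  -- A `0/1`-vector is determined by its weight.
  funext a
  have hwt := hξ.wt_comm c a
  simp only [exteriorCrystal] at hwt
  grind

lemma existsUnique_isIntervalSchutzenberger_rowCrystal (n : ℕ) {p q : Fin m} {k : ℕ}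
    (hk : p.val + k = q.val + 1) : ∃! ξ, (rowCrystal n m).IsIntervalSchutzenberger p q ξ :=
  existsUnique_isSchutzenberger_transport _ <|
    ((exteriorRestriction (by omega)).tensorPower n).existsUnique_isIntervalSchutzenberger hk
      (existsUnique_isFullSchutzenberger_tensorPower n k)

/-- The matrix obtained from `N` by applying `evac` to its block of columns `[p, p + k)`. -/
noncomputable def evacColumns {p k : ℕ} (h : p + k ≤ m) (N : Matrix (Fin n) (Fin m) Bool) :
    Matrix (Fin n) (Fin m) Bool :=
  Matrix.of fun r => Function.extend (shiftPos h) (evac (N.submatrix id (shiftPos h)) r) (N r)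

lemma innerAction_eq {p q : Fin m} {k : ℕ} (h : p.val + k ≤ m) (hk : p.val + k = q.val + 1) :
    innerAction n m p q = evacColumns h :=
  innerCactus_eq (existsUnique_isIntervalSchutzenberger_rowCrystal n hk) <|
    (((exteriorRestriction h).tensorPower n).isIntervalSchutzenberger hk
      (isFullSchutzenberger_tensorPower n k)).transport (rowTensor n m)

lemma outerAction_eq {p q : Fin m} (h : p.val + (p.rev.val - q.rev.val + 1) ≤ m) (hpq : p ≤ q) :
    outerAction n m q.rev p.rev = evacColumns (n := n) h := by
  funext N
  have hcols : (fun j : Fin (p.rev.val - q.rev.val + 1) => (exteriorCrystal n).schutzenberger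
      (colTensor n m N ⟨p.rev.val - j.val, by omega⟩)) =
      rowTensor _ _ (rot (rot (rot (N.submatrix id (shiftPos h))))) := by
    funext j r
    rw [schutzenberger_exteriorCrystal]
    refine congrArg (N r.rev) (Fin.ext ?_)
    simp only [shiftPos, Fin.val_rev]
    omega
  ext r c
  simp only [outerAction, outerCactus, hcols, schutzenberger_rowTensor, evac_rot_rot_rot]
  simp only [evacColumns, colTensor, Equiv.coe_fn_symm_mk, Matrix.of_apply]
  by_cases hc : ∃ x, shiftPos h x = c
  · obtain ⟨x, rfl⟩ := hc
    rw [(shiftPos_injective h).extend_apply, dif_pos (by simp only [shiftPos, Fin.val_rev]; omega)]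
    refine congrArg (evac (N.submatrix id (shiftPos h)) r) (Fin.ext ?_)
    simp only [shiftPos, Fin.val_rev]
    omega
  · have hout : ¬ (q.rev.val ≤ c.rev.val ∧ c.rev.val ≤ p.rev.val) := by
      rintro ⟨hcq, hpc⟩
      simp only [Fin.val_rev] at hcq hpc hc
      refine hc ⟨⟨c - p, by omega⟩, Fin.ext ?_⟩
      simp only [shiftPos]
      omega
    rw [Function.extend_apply' _ _ _ hc, dif_neg hout, Equiv.coe_fn_mk, Fin.rev_rev]

lemma card_ones_eq_sum_wt (N : Matrix (Fin n) (Fin m) Bool) :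
    (#{x : Fin n × Fin m | N x.1 x.2 = true} : ℤ) = ∑ c, (rowCrystal n m).wt N c := by
  simp only [rowCrystal_wt_apply]
  rw [sum_comm, card_filter, ← Fintype.sum_prod_type']
  push_cast
  rfl

lemma innerAction_mem_LambdaB {p q : Fin m} {k : ℕ} (hk : p.val + k = q.val + 1)
    {N : Matrix (Fin n) (Fin m) Bool} (hN : N ∈ LambdaB K n m) :
    innerAction n m p q N ∈ LambdaB K n m := by
  have huniq := existsUnique_isIntervalSchutzenberger_rowCrystal n hk
  obtain ⟨ξ, hξ⟩ := huniq.exists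
  have hsum := hξ.sum_wt_apply (intervalRev_involutive p q) N
  rw [← card_ones_eq_sum_wt, ← card_ones_eq_sum_wt, Nat.cast_inj] at hsum
  rw [innerAction, innerCactus_eq huniq hξ]
  exact hsum.trans hN

lemma outerAction_eq_innerAction {p q : Fin m} (hpq : p ≤ q) :
    outerAction n m q.rev p.rev = innerAction n m p q := by
  have hk : p.val + (p.rev.val - q.rev.val + 1) = q.val + 1 := by
    simp only [Fin.val_rev]
    omega
  rw [outerAction_eq (by omega) hpq, innerAction_eq (by omega) hk]

end CactusActions

/-- The first three conjuncts say that the Schützenberger involutions entering the two actions are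
well defined. Since positions are numbered from `0`, `Fin.rev p` is the position `m + 1 - p` in the
numbering from `1`. -/
theorem mainTheorem4 (n m K : ℕ) (p q : Fin m) (hpq : p < q) :
    (∃! ξ, (exteriorCrystal n).IsFullSchutzenberger ξ) ∧
    (∃! ξ, ((exteriorCrystal n).tensorPower (q.val - p.val + 1)).IsFullSchutzenberger ξ) ∧
    (∃! ξ, (rowCrystal n m).IsIntervalSchutzenberger p q ξ) ∧
    ∀ N ∈ LambdaB K n m,
      outerAction n m q.rev p.rev N ∈ LambdaB K n m ∧
      outerAction n m q.rev p.rev N = innerAction n m p q N := by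
  have hk : p.val + (q.val + 1 - p.val) = q.val + 1 := by omega
  refine ⟨existsUnique_isFullSchutzenberger_exteriorCrystal n,
    existsUnique_isFullSchutzenberger_tensorPower _ n,
    existsUnique_isIntervalSchutzenberger_rowCrystal n hk, fun N hN => ?_⟩
  rw [outerAction_eq_innerAction hpq.le]
  exact ⟨innerAction_mem_LambdaB hk hN, rfl⟩
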